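/- **Model.** For $k\in\{1,2\}$ let $\mathbf X^{(k)}$ be an $n^{(k)}\times q$ random matrix ($n^{(k)}\ge 1$) whose columns have $\ell_2$ norm $\sqrt{n^{(k)}}$, and let $$\mathbf Y^{(k)}=\mathbf Y^{(k)}\boldsymbol\Gamma^{(k)}+\mathbf X^{(k)}\boldsymbol\Phi^{(k)}+\mathcal E^{(k)},$$ where $\boldsymbol\Gamma^{(k)}\in\mathbb R^{p\times p}$ has zero diagonal, $\boldsymbol\Phi^{(k)}\in\mathbb R^{q\times p}$, and the entries of $\mathcal E^{(1)},\mathcal E^{(2)}$ are mutually independent and jointly independent of $(\mathbf X^{(1)},\mathbf X^{(2)})$, those in column $i$ of $\mathcal E^{(k)}$ being $N(0,(\sigma_i^{(k)})^2)$ with $\sigma_i^{(k)}\le\sigma_{\max}$. Put $\boldsymbol\pi^{(k)}=\boldsymbol\Phi^{(k)}(\mathbf I-\boldsymbol\Gamma^{(k)})^{-1}$ and $\mathcal A_i^{(k)}=\operatorname{supp}(\boldsymbol\phi_i^{(k)})$, with $\boldsymbol\phi_i^{(k)}$ the $i$-th column of $\boldsymbol\Phi^{(k)}$. Node $j$ regulates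 node $i$ in network $k$ if there is a directed path of positive length from $j$ to $i$, with an edge $a\to b$ when $\Gamma^{(k)}_{ab}\neq0$. Let $\mathcal M_{i0}^{(k)}$ be the union of $\mathcal A_i^{(k)}$ and of all $\mathcal A_j^{(k)}$ with $j$ regulating $i$, and let $\mathcal M_i^{(k)}\supseteq\mathcal M_{i0}^{(k)}$ be given (screened, non-random) subsets of $\{1,\dots,q\}$, all with $d$ elements. **Calibration stage.** With ridge parameters $\lambda_i^{(k)}\ge0$, let $\hat{\boldsymbol\pi}_i^{(k)}$ be the ridge estimate $(\mathbf X_{\mathcal M}^{T}\mathbf X_{\mathcal M}+\lambda_i^{(k)}\mathbf I)^{-1}\mathbf X_{\mathcal M}^{T}\mathbf Y_i^{(k)}$, where $\mathbf X_{\mathcal M}$ consists of the columns of $\mathbf X^{(k)}$ in $\mathcal M_i^{(k)}$, extended by zero; let $\hat{\mathbf Y}^{(k)}=\mathbf X^{(k)}\hat{\boldsymbol\pi}^{(k)}$. Let $$\boldsymbol\Pi=\begin{pmatrix}\boldsymbol\pi^{(1)}&\boldsymbol\pi^{(1)}\\ \boldsymbol\pi^{(2)}&-\boldsymbol\pi^{(2)}\end{pmatrix},\qquad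 \hat{\mathbf Z}_{-i}=\begin{pmatrix}\hat{\mathbf Y}^{(1)}_{-i}&\hat{\mathbf Y}^{(1)}_{-i}\\ \hat{\mathbf Y}^{(2)}_{-i}&-\hat{\mathbf Y}^{(2)}_{-i}\end{pmatrix},\qquad \mathbf X=\operatorname{diag}\{\mathbf X^{(1)},\mathbf X^{(2)}\},$$ where the subscript $-i$ means that the $i$-th column is deleted, and define $\boldsymbol\Pi_{-i}$ (from $\boldsymbol\pi^{(k)}_{-i}$) and $\hat{\boldsymbol\Pi}$ (from $\hat{\boldsymbol\pi}^{(k)}$) in the same way. **Construction stage.** Let $\boldsymbol\gamma_i^{(k)}$ be the $i$-th column of $\boldsymbol\Gamma^{(k)}$ without its $i$-th entry, $\boldsymbol\beta_i=\big((\boldsymbol\gamma_i^{(1)}+\boldsymbol\gamma_i^{(2)})/2,\ (\boldsymbol\gamma_i^{(1)}-\boldsymbol\gamma_i^{(2)})/2\big)$ (average and differential effects), $\mathcal S_i=\operatorname{supp}\boldsymbol\beta_i$, $\mathbf B=[\boldsymbol\beta_1,\dots,\boldsymbol\beta_p]$, $\mathbf Y_i$ the stacked $i$-th columns of $\mathbf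 Y^{(1)},\mathbf Y^{(2)}$, and $\mathbf H_i=\operatorname{diag}\{\mathbf H_i^{(1)},\mathbf H_i^{(2)}\}$, with $\mathbf H_i^{(k)}$ the orthogonal projection off the columns of $\mathbf X^{(k)}$ in $\mathcal A_i^{(k)}$. Let $n=n^{(1)}+n^{(2)}$. For positive weights $\boldsymbol\omega_i$ and tuning parameter $\lambda_i$ (both may depend on the data), let $\hat{\boldsymbol\beta}_i$ be any minimizer of $$\tfrac1n\|\mathbf H_i\mathbf Y_i-\mathbf H_i\hat{\mathbf Z}_{-i}\boldsymbol\beta\|_2^2+\lambda_i\boldsymbol\omega_i^T|\boldsymbol\beta|.$$ **Notation.** $\|\cdot\|_1$ of a matrix is the maximal column sum of absolute values; $\|v\|_\infty$, $\|v\|_{-\infty}$ are the largest and smallest absolute values of the entries of $v$; $n_{\min}=\min(n^{(1)},n^{(2)})$, $r_i^{(k)}=(\lambda_i^{(k)})^2\|\boldsymbol\pi_i^{(k)}\|_2^2/n^{(k)}$, $r_{\max}=\max_{i,k}r_i^{(k)}$; $f^{(1)},f^{(2)}$ are prescribed real numbers, $f_{\max}=\max(f^{(1)},f^{(2)})$,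 $R=d\vee r_{\max}\vee f_{\max}$, and $$h_n=(\|\mathbf B\|_1^2\wedge1)\big((n\|\boldsymbol\Pi\|_1^2/d)\wedge R\big)\log p .$$ **Assumptions**, with constants $\kappa\in\mathbb R$ and $c,\sigma_{\max},c_1^{(k)},c_2^{(k)}>0$; let $c_{\max}=c_1^{(1)}\vee c_1^{(2)}$. 1. $\mathcal A_i^{(k)}\ne\emptyset$ if node $i$ regulates some node in network $k$; $\mathcal A_i^{(k)}\cap\mathcal A_j^{(k)}=\emptyset$ for $i\ne j$. 2. $n^{(1)}\le\kappa n^{(2)}$, $n^{(2)}\le\kappa n^{(1)}$, $p\le\kappa q$, $q\le\kappa p$. 3. The singular values of $\mathbf I-\boldsymbol\Gamma^{(k)}$ are at least $c$, and $c_2^{(k)}\le (n^{(k)})^{-1/2}\|\mathbf X^{(k)}_{\mathcal M_i^{(k)}}\delta\|_2\le c_1^{(k)}$ for every node $i$ and every $\delta$ with $\|\delta\|_2=1$. 4. (For node $i$.) There is $\phi_0>0$ with $\|\mathbf H_i\mathbf X\boldsymbol\Pi_{-i}\delta\|_2\ge\phi_0\sqrt n\,\|\delta_{\mathcal S_i}\|_2$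 whenever $\|\delta_{\mathcal S_i^c}\|_1\le3\|\delta_{\mathcal S_i}\|_1$; and $\|\boldsymbol\omega_{\mathcal S_i}\|_\infty\le\|\boldsymbol\omega_{\mathcal S_i^c}\|_{-\infty}$. **Theorem.** There are positive constants $C_2$ and $t_0$, depending only on $\kappa,c,\sigma_{\max},c_1^{(k)},c_2^{(k)}$, with the following properties. First, under Assumptions 1–3, for each column $j\in\{1,\dots,2p\}$, $\|\mathbf X(\hat{\boldsymbol\Pi}_j-\boldsymbol\Pi_j)\|_2^2\le C_2R$ with probability at least $1-e^{-f^{(1)}}-e^{-f^{(2)}}$. Second, for every $T\ge t_0$ there are positive constants $C_3,C_4$, depending only on $T$ and the same quantities, such that the following holds under Assumptions 1–4 for node $i$. Suppose that $$t_0\,\rho\le\lambda_i\le T\,\rho,\qquad \rho=\|\boldsymbol\omega_i\|_{-\infty}^{-1}\|\mathbf B\|_1\|\boldsymbol\Pi\|_1\sqrt{R\log(p)/n_{\min}},$$ and, if $\mathcal S_i\neq\emptyset$, $$\sqrt{R/n}+c_{\max}\|\boldsymbol\Pi\|_1\le\sqrt{c_{\max}^2\|\boldsymbol\Pi\|_1^2+\phi_0^2/(64C_2|\mathcal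 S_i|)} .$$ Then, with probability at least $1-3e^{-C_3h_n+\log(4pq)}-e^{-f^{(1)}+\log p}-e^{-f^{(2)}+\log p}$, both bounds hold: $$\|\hat{\boldsymbol\beta}_i-\boldsymbol\beta_i\|_1\le8C_4|\mathcal S_i|\frac{\|\boldsymbol\omega_{\mathcal S_i}\|_\infty\|\mathbf B\|_1\|\boldsymbol\Pi\|_1}{\phi_0^2\|\boldsymbol\omega_i\|_{-\infty}}\sqrt{\frac{R\log p}{n_{\min}}},$$ $$\frac1n\|\mathbf H_i\hat{\mathbf Z}_{-i}(\hat{\boldsymbol\beta}_i-\boldsymbol\beta_i)\|_2^2\le C_4^2|\mathcal S_i|\frac{\|\boldsymbol\omega_{\mathcal S_i}\|_\infty^2\|\mathbf B\|_1^2\|\boldsymbol\Pi\|_1^2}{\phi_0^2\|\boldsymbol\omega_i\|_{-\infty}^2}\cdot\frac{R\log p}{n_{\min}} .$$ -/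

import Mathlib

open MeasureTheory ProbabilityTheory
open scoped NNReal ENNReal

universe u

namespace ReDNet

noncomputable section

/-! ### Norms, supports, restricted eigenvalue -/

/-- The `ℓ₂` norm of a real vector. -/
def l2norm {ι : Type*} [Fintype ι] (v : ι → ℝ) : ℝ := ‖WithLp.toLp 2 v‖

/-- The `ℓ₁` norm of a real vector. -/
def l1norm {ι : Type*} [Fintype ι] (v : ι → ℝ) : ℝ := ∑ j, |v j|

/-- The matrix norm `‖A‖₁`: the maximum over the columns of the sum of absolute values. -/
def matNorm1 {m ι : Type*} [Fintype m] (A : Matrix m ι ℝ) : ℝ := ⨆ j, ∑ r, |A r j|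

/-- `‖v_S‖_∞`, the maximum of `|v j|` over `j ∈ S` (it is `0` when `S` is empty). -/
def maxAbsOn {ι : Type*} (v : ι → ℝ) (S : Finset ι) : ℝ := ⨆ j : S, |v j|

/-- `‖v‖_{-∞}`, the minimum of the absolute values of the components. -/
def minAbs {ι : Type*} (v : ι → ℝ) : ℝ := ⨅ j, |v j|

/-- The set of indices of the nonzero components. -/
def supp {ι : Type*} [Fintype ι] (v : ι → ℝ) : Finset ι := by
  classical exact Finset.univ.filter fun j => v j ≠ 0

/-- The restricted eigenvalue of the matrix `A` (with `n` rows) on the index set `S`: the infimum of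
`‖A δ‖₂ / (√n ‖δ_S‖₂)` over the vectors with `‖δ_{Sᶜ}‖₁ ≤ 3 ‖δ_S‖₁` and `δ_S ≠ 0`. It is taken in
the extended reals, so that it is `+∞` when there is no such vector. -/
def restrictedEigenvalue {m ι : Type*} [Fintype m] [Fintype ι] [DecidableEq ι]
    (A : Matrix m ι ℝ) (S : Finset ι) : EReal :=
  ⨅ (δ : ι → ℝ) (_ : ∑ j ∈ Sᶜ, |δ j| ≤ 3 * ∑ j ∈ S, |δ j|) (_ : ∃ j ∈ S, δ j ≠ 0),
    ((l2norm (A.mulVec δ) /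
      (√(Fintype.card m : ℝ) * l2norm (fun j : S => δ j)) : ℝ) : EReal)

/-! ### Matrices built from the data -/

/-- The submatrix of the columns indexed by `M`. -/
def colsOn {m ι : Type*} (A : Matrix m ι ℝ) (M : Finset ι) : Matrix m M ℝ :=
  A.submatrix id Subtype.val

/-- The submatrix `A_{-i}` obtained by deleting the `i`-th column. -/
def dropCol {m : Type*} {p : ℕ} (i : Fin p) (A : Matrix m (Fin p) ℝ) :
    Matrix m {j : Fin p // j ≠ i} ℝ :=
  A.submatrix id Subtype.val

/-- The two networks are indexed by `0` and `1`; from a pair of matrices `A₀`, `A₁` with the same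
columns this is the block matrix with block rows `(A₀, A₀)` and `(A₁, -A₁)`. -/
def reparam {ρ : Fin 2 → Type*} {κ : Type*} (A : ∀ k, Matrix (ρ k) κ ℝ) :
    Matrix ((k : Fin 2) × ρ k) (κ ⊕ κ) ℝ :=
  Matrix.of fun r => Sum.elim (fun j => A r.1 r.2 j)
    (fun j => (if r.1 = 0 then 1 else -1) * A r.1 r.2 j)

/-- The projection matrix `I - X_A (X_Aᵀ X_A)⁻¹ X_Aᵀ`. -/
def projOff {m ι : Type*} [Fintype m] [DecidableEq m] [DecidableEq ι]
    (X : Matrix m ι ℝ) (A : Finset ι) : Matrix m m ℝ :=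
  1 - colsOn X A * ((colsOn X A).transpose * colsOn X A)⁻¹ * (colsOn X A).transpose

/-- The ridge estimate `(X_Mᵀ X_M + lam I)⁻¹ X_Mᵀ y`, extended by zero outside `M`. -/
def ridge {m ι : Type*} [Fintype m] [DecidableEq ι]
    (X : Matrix m ι ℝ) (M : Finset ι) (lam : ℝ) (y : m → ℝ) : ι → ℝ := fun l =>
  if h : l ∈ M then
    (((colsOn X M).transpose * colsOn X M + lam • (1 : Matrix M M ℝ))⁻¹.mulVec
      ((colsOn X M).transpose.mulVec y)) ⟨l, h⟩
  else 0

/-! ### Parameters of the structural equation models -/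

section Parameters

variable {p q : ℕ}

/-- `π = Φ (I - Γ)⁻¹`, the coefficient matrix of the reduced form. -/
def reducedCoef (Γ : Matrix (Fin p) (Fin p) ℝ) (Φ : Matrix (Fin q) (Fin p) ℝ) :
    Matrix (Fin q) (Fin p) ℝ :=
  Φ * (1 - Γ)⁻¹

/-- The anchoring set of node `i`: the support of the `i`-th column of `Φ`. -/
def anchors (Φ : Matrix (Fin q) (Fin p) ℝ) (i : Fin p) : Finset (Fin q) :=
  supp fun l => Φ l i

/-- Node `j` regulates node `i`, directly or indirectly: there is a directed path of positive length
from `j` to `i`, an edge `a → b` being a nonzero entry `Γ a b`. -/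
def Regulates (Γ : Matrix (Fin p) (Fin p) ℝ) (j i : Fin p) : Prop :=
  Relation.TransGen (fun a b => Γ a b ≠ 0) j i

/-- The exogenous variables which directly or indirectly regulate node `i`: the anchors of `i` and
those of the nodes that regulate `i`. -/
def exoRegulators (Γ : Matrix (Fin p) (Fin p) ℝ) (Φ : Matrix (Fin q) (Fin p) ℝ) (i : Fin p) :
    Set (Fin q) :=
  {l | ∃ j, (j = i ∨ Regulates Γ j i) ∧ l ∈ anchors Φ j}

/-- `β_i = (β_i⁺, β_i⁻)`: half the sum and half the difference of the effects of the other nodes on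
node `i` in the two networks. -/
def effects (Γ : Fin 2 → Matrix (Fin p) (Fin p) ℝ) (i : Fin p) :
    {j : Fin p // j ≠ i} ⊕ {j : Fin p // j ≠ i} → ℝ :=
  Sum.elim (fun j => (Γ 0 j i + Γ 1 j i) / 2) (fun j => (Γ 0 j i - Γ 1 j i) / 2)

end Parameters

/-- The constants that occur in the assumptions and on which alone the constants of the error bounds
may depend. -/
structure ModelConstants where
  /-- bounds the ratios of the two sample sizes and of the numbers of variables -/
  κ : ℝ
  /-- lower bound of the singular values of `I - Γ` -/
  c : ℝ
  /-- upper bound of the standard deviations of the errors -/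
  σmax : ℝ
  /-- upper bounds of the designs of the two networks -/
  c₁ : Fin 2 → ℝ
  /-- lower bounds of the designs of the two networks -/
  c₂ : Fin 2 → ℝ
  c_pos : 0 < c
  σmax_pos : 0 < σmax
  c₁_pos : ∀ k, 0 < c₁ k
  c₂_pos : ∀ k, 0 < c₂ k

/-- `c_max`, the larger of the two upper bounds of the designs. -/
def ModelConstants.cmax (K : ModelConstants) : ℝ := max (K.c₁ 0) (K.c₁ 1)

/-- A pair of networks on the probability space `(Ω, P)`, with its data, the screened sets and the
ridge parameters of the calibration stage, under the model and Assumptions 1, 2 and 3. -/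
structure Setting {Ω : Type*} [MeasurableSpace Ω] (P : Measure Ω) (K : ModelConstants) where
  /-- sample sizes -/
  n : Fin 2 → ℕ
  /-- number of nodes (endogenous variables) -/
  p : ℕ
  /-- number of exogenous variables -/
  q : ℕ
  /-- number of screened exogenous variables -/
  d : ℕ
  /-- regulatory effects: `Γ k j i` is the effect of node `j` on node `i` in network `k` -/
  Γ : Fin 2 → Matrix (Fin p) (Fin p) ℝ
  /-- anchoring effects -/
  Φ : Fin 2 → Matrix (Fin q) (Fin p) ℝ
  /-- standard deviations of the errors -/
  σ : Fin 2 → Fin p → ℝ≥0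
  /-- exogenous data -/
  X : Ω → ∀ k, Matrix (Fin (n k)) (Fin q) ℝ
  /-- errors -/
  E : Ω → ∀ k, Matrix (Fin (n k)) (Fin p) ℝ
  /-- endogenous data -/
  Y : Ω → ∀ k, Matrix (Fin (n k)) (Fin p) ℝ
  /-- screened sets -/
  M : Fin 2 → Fin p → Finset (Fin q)
  /-- ridge parameters -/
  ridgeParam : Fin 2 → Fin p → ℝ
  /-- the prespecified numbers that govern the probability of the first-stage bounds -/
  f : Fin 2 → ℝ
  -- The model.
  n_pos : ∀ k, 0 < n k
  Γ_diag : ∀ k i, Γ k i i = 0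
  sem : ∀ w k, Y w k = Y w k * Γ k + X w k * Φ k + E w k
  standardized : ∀ w k l, l2norm (fun r => X w k r l) = √(n k : ℝ)
  measurable_X : ∀ k r l, Measurable fun w => X w k r l
  law_E : ∀ k r i, HasLaw (fun w => E w k r i) (gaussianReal 0 (σ k i ^ 2)) P
  indep_E : iIndepFun
    (fun (e : (k : Fin 2) × (Fin (n k) × Fin p)) (w : Ω) => E w e.1 e.2.1 e.2.2) P
  indep_XE : IndepFun (fun w => (fun k r l => X w k r l : ∀ k, Fin (n k) → Fin q → ℝ))
    (fun w => (fun k r i => E w k r i : ∀ k, Fin (n k) → Fin p → ℝ)) P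
  σ_le : ∀ k i, (σ k i : ℝ) ≤ K.σmax
  -- The screened sets have `d` elements and contain all relevant exogenous variables.
  card_M : ∀ k i, (M k i).card = d
  screening : ∀ k i, exoRegulators (Γ k) (Φ k) i ⊆ (M k i : Set (Fin q))
  -- Assumption 1.
  anchors_nonempty : ∀ k i, (∃ j, Regulates (Γ k) i j) → (anchors (Φ k) i).Nonempty
  anchors_disjoint : ∀ k i j, i ≠ j → Disjoint (anchors (Φ k) i) (anchors (Φ k) j)
  -- Assumption 2.
  n_ratio : ∀ k k', (n k : ℝ) ≤ K.κ * n k'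
  p_le : (p : ℝ) ≤ K.κ * q
  q_le : (q : ℝ) ≤ K.κ * p
  -- Assumption 3; the first condition says that the singular values of `I - Γ` are at least `c`.
  singular_ge : ∀ k (v : Fin p → ℝ), l2norm v = 1 → K.c ≤ l2norm ((1 - Γ k).mulVec v)
  design_le : ∀ w k i (δ : M k i → ℝ), l2norm δ = 1 →
    (√(n k : ℝ))⁻¹ * l2norm ((colsOn (X w k) (M k i)).mulVec δ) ≤ K.c₁ k
  design_ge : ∀ w k i (δ : M k i → ℝ), l2norm δ = 1 →
    K.c₂ k ≤ (√(n k : ℝ))⁻¹ * l2norm ((colsOn (X w k) (M k i)).mulVec δ)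
  ridgeParam_nonneg : ∀ k i, 0 ≤ ridgeParam k i

namespace Setting

variable {Ω : Type*} [MeasurableSpace Ω] {P : Measure Ω} {K : ModelConstants} (S : Setting P K)

/-- `n = n⁽¹⁾ + n⁽²⁾`. -/
def nTot : ℝ := (S.n 0 : ℝ) + S.n 1

/-- `n_min`. -/
def nMin : ℝ := min (S.n 0 : ℝ) (S.n 1)

/-- `π⁽ᵏ⁾`. -/
def coef (k : Fin 2) : Matrix (Fin S.q) (Fin S.p) ℝ := reducedCoef (S.Γ k) (S.Φ k)

/-- The matrix `Π`. -/
def Pi : Matrix ((_ : Fin 2) × Fin S.q) (Fin S.p ⊕ Fin S.p) ℝ := reparam S.coef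

/-- The matrix `Π_{-i}`. -/
def PiDrop (i : Fin S.p) :
    Matrix ((_ : Fin 2) × Fin S.q) ({j : Fin S.p // j ≠ i} ⊕ {j : Fin S.p // j ≠ i}) ℝ :=
  reparam fun k => dropCol i (S.coef k)

/-- The block diagonal matrix `X = diag{X⁽¹⁾, X⁽²⁾}`. -/
def XX (w : Ω) : Matrix ((k : Fin 2) × Fin (S.n k)) ((_ : Fin 2) × Fin S.q) ℝ :=
  Matrix.blockDiagonal' (S.X w)

/-- The calibration stage: the ridge estimates of the columns of `π⁽ᵏ⁾`. -/
def coefHat (w : Ω) (k : Fin 2) : Matrix (Fin S.q) (Fin S.p) ℝ :=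
  Matrix.of fun l i => ridge (S.X w k) (S.M k i) (S.ridgeParam k i) (fun r => S.Y w k r i) l

/-- The estimate of `Π`. -/
def PiHat (w : Ω) : Matrix ((_ : Fin 2) × Fin S.q) (Fin S.p ⊕ Fin S.p) ℝ := reparam (S.coefHat w)

/-- The prediction of `Y⁽ᵏ⁾` from the calibration stage. -/
def YHat (w : Ω) (k : Fin 2) : Matrix (Fin (S.n k)) (Fin S.p) ℝ := S.X w k * S.coefHat w k

/-- The prediction of `Z_{-i}`. -/
def ZHatDrop (w : Ω) (i : Fin S.p) :
    Matrix ((k : Fin 2) × Fin (S.n k)) ({j : Fin S.p // j ≠ i} ⊕ {j : Fin S.p // j ≠ i}) ℝ :=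
  reparam fun k => dropCol i (S.YHat w k)

/-- `H_i = diag{H_i⁽¹⁾, H_i⁽²⁾}`. -/
def H (w : Ω) (i : Fin S.p) : Matrix ((k : Fin 2) × Fin (S.n k)) ((k : Fin 2) × Fin (S.n k)) ℝ :=
  Matrix.blockDiagonal' fun k => projOff (S.X w k) (anchors (S.Φ k) i)

/-- The stacked response `Y_i`. -/
def Yi (w : Ω) (i : Fin S.p) : (k : Fin 2) × Fin (S.n k) → ℝ := fun r => S.Y w r.1 r.2 i

/-- The parameter `β_i`. -/
def beta (i : Fin S.p) : {j : Fin S.p // j ≠ i} ⊕ {j : Fin S.p // j ≠ i} → ℝ := effects S.Γ i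

/-- `S_i = supp β_i`. -/
def active (i : Fin S.p) : Finset ({j : Fin S.p // j ≠ i} ⊕ {j : Fin S.p // j ≠ i}) :=
  supp (S.beta i)

/-- `‖B‖₁` for the matrix `B` with columns `β_1, …, β_p`. -/
def normB : ℝ := ⨆ i, l1norm (S.beta i)

/-- `‖Π‖₁`. -/
def normPi : ℝ := matNorm1 S.Pi

/-- `r_i⁽ᵏ⁾`, the squared ridge parameter times `‖π_i⁽ᵏ⁾‖₂²` over `n⁽ᵏ⁾`. -/
def r (k : Fin 2) (i : Fin S.p) : ℝ :=
  S.ridgeParam k i ^ 2 * l2norm (fun l => S.coef k l i) ^ 2 / S.n k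

/-- `r_max`. -/
def rMax : ℝ := ⨆ i, max (S.r 0 i) (S.r 1 i)

/-- `f_max`. -/
def fMax : ℝ := max (S.f 0) (S.f 1)

/-- `d ∨ r_max ∨ f_max`. -/
def R : ℝ := max (S.d : ℝ) (max S.rMax S.fMax)

/-- `h_n`. -/
def h : ℝ := min (S.normB ^ 2) 1 * min (S.nTot * S.normPi ^ 2 / S.d) S.R * Real.log S.p

/-- The rate `‖B‖₁ ‖Π‖₁ √((d ∨ r_max ∨ f_max) log p / n_min)`. -/
def rate : ℝ := S.normB * S.normPi * √(S.R * Real.log S.p / S.nMin)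

/-- The objective function of the adaptive lasso for node `i`, with weights `ω` and tuning parameter
`lam`. -/
def lassoObjective (w : Ω) (i : Fin S.p) (ω : {j : Fin S.p // j ≠ i} ⊕ {j : Fin S.p // j ≠ i} → ℝ)
    (lam : ℝ) (b : {j : Fin S.p // j ≠ i} ⊕ {j : Fin S.p // j ≠ i} → ℝ) : ℝ :=
  1 / S.nTot *
      l2norm ((S.H w i).mulVec (S.Yi w i) - (S.H w i).mulVec ((S.ZHatDrop w i).mulVec b)) ^ 2 +
    lam * ∑ j, ω j * |b j|

/-- The construction stage: `b` is an adaptive lasso estimate of `β_i`. -/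
def IsAdaptiveLasso (w : Ω) (i : Fin S.p)
    (ω : {j : Fin S.p // j ≠ i} ⊕ {j : Fin S.p // j ≠ i} → ℝ) (lam : ℝ)
    (b : {j : Fin S.p // j ≠ i} ⊕ {j : Fin S.p // j ≠ i} → ℝ) : Prop :=
  IsMinOn (S.lassoObjective w i ω lam) Set.univ b

/-- Assumption 4 for node `i`: the restricted eigenvalue of `H_i X Π_{-i}` on `S_i` is at least `φ₀`,
and the largest weight on `S_i` does not exceed the smallest one off `S_i`. -/
structure Assumption4 (i : Fin S.p)
    (ω : Ω → {j : Fin S.p // j ≠ i} ⊕ {j : Fin S.p // j ≠ i} → ℝ) (φ₀ : ℝ) : Prop where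
  φ₀_pos : 0 < φ₀
  restricted_eigenvalue : ∀ w,
    (φ₀ : EReal) ≤ restrictedEigenvalue (S.H w i * S.XX w * S.PiDrop i) (S.active i)
  weights : ∀ w, ∀ j ∈ S.active i, ∀ l ∉ S.active i, |ω w j| ≤ |ω w l|

/-- `C₂` bounds the prediction loss of the calibration stage: for each column,
`‖X (Π̂_j - Π_j)‖₂² ≤ C₂ (d ∨ r_max ∨ f_max)` with probability at least
`1 - exp(-f⁽¹⁾) - exp(-f⁽²⁾)`. -/
def CalibrationBound (C₂ : ℝ) : Prop :=
  ∀ j : Fin S.p ⊕ Fin S.p,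
    ENNReal.ofReal (1 - Real.exp (-S.f 0) - Real.exp (-S.f 1)) ≤
      P {w | l2norm ((S.XX w).mulVec fun l => S.PiHat w l j - S.Pi l j) ^ 2 ≤ C₂ * S.R}

end Setting

end

end ReDNet

/-! Two random quantities have to be controlled: the scores of the calibration stage and the
correlations of the exogenous variables with the projected errors. The rest is deterministic.

In the reduced form `Y = X π + ε`, `ε = E (1 - Γ)⁻¹`, column `i` of `π` is supported in the screened
set. The ridge error therefore solves a `d`-dimensional normal equation whose right-hand side is the
score `X_Mᵀ ε` minus the ridge bias. With `X` frozen, the score has `d` jointly sub-Gaussian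
coordinates, so its squared norm is of order `n R` outside an event of probability `exp (-f)`
(`measure_not_scoreBound_le`). As the design is well conditioned on the screened set, the prediction
error is of order `R` (`l2norm_mulVec_dev_sq_le`).

In the construction stage `H_i` kills the anchoring term. The residual at the true `β_i` is then
`H_i` applied to `ε_i` minus the calibration errors weighted by the effects on node `i`
(`residual_apply`). The lasso needs each calibrated regressor to be nearly uncorrelated with this
residual. A regressor is a true column plus a calibration error. Both are paired with `ε_i` through
the `ℓ₁`-`ℓ_∞` inequality, where the correlations are bounded by `√n⁽ᵏ⁾` times `corrLevel`. Of the
minimum in `corrLevel`, the bound by `R` serves the true column and the bound by `n ‖Π‖₁² / d` the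
calibration error, whose `ℓ₁` norm costs a factor `√d`. The pairing with the calibration errors in
the residual uses Cauchy-Schwarz. All terms are at most a constant times `rate`
(`four_div_mul_le_rate`), which determines `t₀`.

The restricted eigenvalue passes from `H X Π_{-i}` to the calibrated regressors with a loss of one
half: each column moves by at most `√(C₂ R)`, and the sample size condition makes this small on the
cone (`Assumption4.calibrated`). The usual lasso argument then applies. If `h ≤ 0`, the asserted
probability is negative and there is nothing to prove. -/

namespace ReDNet

/-! ### Sub-Gaussian concentration and conditioning on the design. -/

section Concentration

variable {Ω : Type*} [MeasurableSpace Ω] {P : Measure Ω}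

lemma hasSubgaussianMGF_of_hasLaw_gaussianReal {X : Ω → ℝ} {v : ℝ≥0}
    (h : HasLaw X (gaussianReal 0 v) P) : HasSubgaussianMGF X v P where
  integrable_exp_mul t := by
    have := integrable_exp_mul_gaussianReal (μ := 0) (v := v) t
    rw [← h.map_eq] at this
    exact this.comp_aemeasurable h.aemeasurable
  mgf_le t := by
    rw [mgf_gaussianReal h.map_eq t]
    simp

lemma hasSubgaussianMGF_mono {X : Ω → ℝ} {c c' : ℝ≥0} (h : HasSubgaussianMGF X c P)
    (hc : c ≤ c') : HasSubgaussianMGF X c' P where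
  integrable_exp_mul := h.integrable_exp_mul
  mgf_le t := (h.mgf_le t).trans <| by
    have : (c : ℝ) ≤ c' := by exact_mod_cast hc
    gcongr

lemma lintegral_exp_le_of_hasSubgaussianMGF {X : Ω → ℝ} {c : ℝ≥0} (h : HasSubgaussianMGF X c P) :
    ∫⁻ w, ENNReal.ofReal (Real.exp (X w)) ∂P ≤ ENNReal.ofReal (Real.exp (c / 2)) := by
  have hi := h.integrable_exp_mul 1
  simp only [one_mul] at hi
  rw [← ofReal_integral_eq_lintegral_ofReal hi (ae_of_all _ fun _ => (Real.exp_pos _).le)]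
  apply ENNReal.ofReal_le_ofReal
  simpa [mgf] using h.mgf_le 1

lemma measure_abs_ge_le_of_hasSubgaussianMGF [IsFiniteMeasure P] {X : Ω → ℝ} {c : ℝ≥0}
    (h : HasSubgaussianMGF X c P) {t : ℝ} (ht : 0 ≤ t) :
    P {w | t ≤ |X w|} ≤ 2 * ENNReal.ofReal (Real.exp (-t ^ 2 / (2 * c))) := by
  have h1 := h.measure_ge_le ht
  have h2 := h.neg.measure_ge_le ht
  have hsub : {w | t ≤ |X w|} ⊆ {w | t ≤ X w} ∪ {w | t ≤ (-X) w} := by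
    intro w hw
    simpa [le_abs] using hw
  have key : ∀ s : Set Ω, P.real s ≤ Real.exp (-t ^ 2 / (2 * c)) →
      P s ≤ ENNReal.ofReal (Real.exp (-t ^ 2 / (2 * c))) := fun s hs => by
    rw [← ofReal_measureReal]
    exact ENNReal.ofReal_le_ofReal hs
  refine (measure_mono hsub).trans ((measure_union_le _ _).trans ?_)
  rw [two_mul]
  exact add_le_add (key _ h1) (key _ h2)

lemma lintegral_exp_mul_gaussianReal (v : ℝ≥0) (t : ℝ) :
    ∫⁻ y, ENNReal.ofReal (Real.exp (y * t)) ∂(gaussianReal 0 v) =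
      ENNReal.ofReal (Real.exp (v * t ^ 2 / 2)) := by
  have hi := integrable_exp_mul_gaussianReal (μ := 0) (v := v) t
  have hm := congrFun (mgf_fun_id_gaussianReal (μ := 0) (v := v)) t
  simp only [mgf, zero_mul, zero_add] at hm
  simp only [mul_comm _ t]
  rw [← ofReal_integral_eq_lintegral_ofReal hi (ae_of_all _ fun _ => (Real.exp_pos _).le), hm]

/-- The factor halves the exponent of the density, which becomes that of a Gaussian with variance `2
v`; the normalizations differ by `√2`. -/
lemma lintegral_exp_sq_gaussianReal {v : ℝ≥0} (hv : 0 < v) :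
    ∫⁻ y, ENNReal.ofReal (Real.exp (y ^ 2 / (4 * v))) ∂(gaussianReal 0 v) =
      ENNReal.ofReal (√2) := by
  have hv' : (0 : ℝ) < v := hv
  rw [gaussianReal_of_var_ne_zero _ hv.ne', lintegral_withDensity_eq_lintegral_mul₀
    (measurable_gaussianPDF _ _).aemeasurable (by fun_prop)]
  have h1 : ∀ y : ℝ, (gaussianPDF 0 v * fun y => ENNReal.ofReal (Real.exp (y ^ 2 / (4 * v)))) y
      = ENNReal.ofReal ((√(2 * Real.pi * v))⁻¹ * Real.exp (-(1 / (4 * v)) * y ^ 2)) := by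
    intro y
    simp only [Pi.mul_apply, gaussianPDF, gaussianPDFReal]
    rw [← ENNReal.ofReal_mul (by positivity), mul_assoc, ← Real.exp_add]
    congr 3
    field_simp
    ring
  simp_rw [h1]
  have hb : (0 : ℝ) < 1 / (4 * v) := by positivity
  rw [← ofReal_integral_eq_lintegral_ofReal ((integrable_exp_neg_mul_sq hb).const_mul _)
    (ae_of_all _ fun _ => by positivity), integral_const_mul, integral_gaussian,
    ← Real.sqrt_inv, ← Real.sqrt_mul (by positivity)]
  congr 2
  field_simp
  norm_num

lemma lintegral_pi_prod {ι : Type*} [Fintype ι] (ν : Measure ℝ) [IsProbabilityMeasure ν]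
    (g : ι → ℝ → ℝ≥0∞) (hg : ∀ l, Measurable (g l)) :
    ∫⁻ y : ι → ℝ, ∏ l, g l (y l) ∂(Measure.pi fun _ => ν) = ∏ l, ∫⁻ t, g l t ∂ν := by
  have hi : iIndepFun (fun l (y : ι → ℝ) => g l (y l)) (Measure.pi fun _ : ι => ν) :=
    iIndepFun_pi fun l => (hg l).aemeasurable
  rw [lintegral_prod_eq_prod_lintegral_of_indepFun _ _ hi
    (fun l => (hg l).comp (measurable_pi_apply l))]
  refine Finset.prod_congr rfl fun l _ => ?_
  exact (measurePreserving_eval (fun _ : ι => ν) l).lintegral_comp (hg l)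

/-- Deviation of the squared norm of a sub-Gaussian random vector, by decoupling with an independent
Gaussian vector. -/
lemma measure_sum_sq_ge_le [IsProbabilityMeasure P] {ι : Type*} [Fintype ι] {v : Ω → ι → ℝ}
    (hv : AEMeasurable v P) {V : ℝ} (hV : 0 < V)
    (hsub : ∀ y : ι → ℝ, HasSubgaussianMGF (fun w => ∑ l, y l * v w l)
      (V * ∑ l, y l ^ 2).toNNReal P) (f : ℝ) :
    P {w | 4 * V * (f + Fintype.card ι) ≤ ∑ l, v w l ^ 2} ≤ ENNReal.ofReal (Real.exp (-f)) := by
  -- This variance satisfies `s / 2 = 1 / (4 V)`, so averaging `exp ⟨y, v⟩` over `y` gives `exp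
  -- (‖v‖² / (4 V))`. It also satisfies `V / 2 = 1 / (4 s)`: after exchanging the integrals, each
  -- coordinate of `y` contributes the Gaussian moment `√2`.
  set s : ℝ≥0 := (1 / (2 * V)).toNNReal with hs
  have hsV : (s : ℝ) = 1 / (2 * V) := Real.coe_toNNReal _ (by positivity)
  have hs0 : 0 < s := by rw [hs]; simpa using hV
  set ν : Measure (ι → ℝ) := Measure.pi fun _ => gaussianReal 0 s with hν
  have hdec : ∀ w, ENNReal.ofReal (Real.exp ((∑ l, v w l ^ 2) / (4 * V))) =
      ∫⁻ y, ENNReal.ofReal (Real.exp (∑ l, y l * v w l)) ∂ν := by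
    intro w
    have : ∀ y : ι → ℝ, ENNReal.ofReal (Real.exp (∑ l, y l * v w l)) =
        ∏ l, ENNReal.ofReal (Real.exp (y l * v w l)) := fun y => by
      rw [Real.exp_sum, ENNReal.ofReal_prod_of_nonneg fun _ _ => (Real.exp_pos _).le]
    simp_rw [this]
    rw [lintegral_pi_prod (gaussianReal 0 s)
      (fun l t => ENNReal.ofReal (Real.exp (t * v w l))) (fun l => by fun_prop)]
    simp_rw [lintegral_exp_mul_gaussianReal]
    rw [← ENNReal.ofReal_prod_of_nonneg fun _ _ => (Real.exp_pos _).le, ← Real.exp_sum]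
    congr 2
    rw [Finset.sum_div]
    refine Finset.sum_congr rfl fun l _ => ?_
    rw [hsV]
    field_simp
    norm_num
  have hexp : ∫⁻ w, ENNReal.ofReal (Real.exp ((∑ l, v w l ^ 2) / (4 * V))) ∂P ≤
      ENNReal.ofReal (√2 ^ Fintype.card ι) := by
    simp_rw [hdec]
    rw [lintegral_lintegral_swap]
    · calc ∫⁻ y, ∫⁻ w, ENNReal.ofReal (Real.exp (∑ l, y l * v w l)) ∂P ∂ν
          ≤ ∫⁻ y, ∏ l, ENNReal.ofReal (Real.exp (y l ^ 2 / (4 * s))) ∂ν := by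
            refine lintegral_mono fun y => (lintegral_exp_le_of_hasSubgaussianMGF (hsub y)).trans_eq ?_
            rw [← ENNReal.ofReal_prod_of_nonneg fun _ _ => (Real.exp_pos _).le, ← Real.exp_sum,
              Real.coe_toNNReal _ (by positivity)]
            congr 2
            rw [Finset.mul_sum, Finset.sum_div]
            refine Finset.sum_congr rfl fun l _ => ?_
            rw [hsV]
            field_simp
            norm_num
        _ = ENNReal.ofReal (√2 ^ Fintype.card ι) := by
            rw [lintegral_pi_prod (gaussianReal 0 s)
              (fun _ t => ENNReal.ofReal (Real.exp (t ^ 2 / (4 * s)))) (fun l => by fun_prop)]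
            simp_rw [lintegral_exp_sq_gaussianReal hs0]
            rw [Finset.prod_const, Finset.card_univ, ENNReal.ofReal_pow (by positivity)]
    · have h1 : AEMeasurable (fun z : Ω × (ι → ℝ) => v z.1) (P.prod ν) :=
        hv.comp_quasiMeasurePreserving Measure.quasiMeasurePreserving_fst
      have h2 : ∀ l, AEMeasurable (fun z : Ω × (ι → ℝ) => v z.1 l) (P.prod ν) := fun l =>
        (measurable_pi_apply l).comp_aemeasurable h1
      have h3 : ∀ l, AEMeasurable (fun z : Ω × (ι → ℝ) => z.2 l) (P.prod ν) := fun l => by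
        fun_prop
      exact (Real.measurable_exp.comp_aemeasurable
        (Finset.aemeasurable_fun_sum _ fun l _ => (h3 l).mul (h2 l))).ennreal_ofReal
  have hmeas : AEMeasurable
      (fun w => ENNReal.ofReal (Real.exp ((∑ l, v w l ^ 2) / (4 * V)))) P := by
    have h2 : ∀ l, AEMeasurable (fun w => v w l) P := fun l =>
      (measurable_pi_apply l).comp_aemeasurable hv
    exact (Real.measurable_exp.comp_aemeasurable
      ((Finset.aemeasurable_fun_sum _ fun l _ => (h2 l).pow_const 2).div_const _)).ennreal_ofReal
  -- The threshold contains the dimension so that it absorbs the moment bound `√2 ^ card ι ≤ exp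
  -- (card ι)` and leaves exactly `exp (-f)`.
  have hmarkov := mul_meas_ge_le_lintegral₀ hmeas
    (ENNReal.ofReal (Real.exp (f + Fintype.card ι)))
  have hset : {w | 4 * V * (f + Fintype.card ι) ≤ ∑ l, v w l ^ 2} ⊆
      {w | ENNReal.ofReal (Real.exp (f + Fintype.card ι)) ≤
        ENNReal.ofReal (Real.exp ((∑ l, v w l ^ 2) / (4 * V)))} := by
    intro w hw
    apply ENNReal.ofReal_le_ofReal
    rw [Real.exp_le_exp, le_div_iff₀ (by positivity)]
    simpa [mul_comm] using hw
  have hpos : 0 < Real.exp (f + Fintype.card ι) := Real.exp_pos _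
  have hsq : √2 ^ Fintype.card ι ≤ Real.exp (Fintype.card ι) := by
    rw [← Real.exp_one_pow]
    gcongr
    have := Real.add_one_le_exp 1
    rw [Real.sqrt_le_left (by positivity)]
    nlinarith
  have hbound : P {w | ENNReal.ofReal (Real.exp (f + Fintype.card ι)) ≤
        ENNReal.ofReal (Real.exp ((∑ l, v w l ^ 2) / (4 * V)))} ≤
      ENNReal.ofReal (Real.exp (-f)) := by
    rw [mul_comm] at hmarkov
    have h4 := (ENNReal.le_div_iff_mul_le (Or.inl (by simpa using hpos))
      (Or.inl ENNReal.ofReal_ne_top)).2 (hmarkov.trans hexp)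
    refine h4.trans ?_
    rw [← ENNReal.ofReal_div_of_pos hpos]
    apply ENNReal.ofReal_le_ofReal
    rw [div_le_iff₀ hpos, ← Real.exp_add]
    refine hsq.trans_eq ?_
    congr 1
    ring
  exact (measure_mono hset).trans hbound

/-- For independent `X` and `E`, an event that has probability at most `ε` for every frozen value
of `X` has probability at most `ε`. -/
lemma measure_le_of_indepFun [IsProbabilityMeasure P] {α β : Type*} [MeasurableSpace α]
    [MeasurableSpace β] {X : Ω → α} {E : Ω → β} (hX : Measurable X) (hE : AEMeasurable E P)
    (hXE : IndepFun X E P) {B : Set (α × β)} (hB : MeasurableSet B) {ε : ℝ≥0∞}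
    (h : ∀ w', P {w | (X w', E w) ∈ B} ≤ ε) : P {w | (X w, E w) ∈ B} ≤ ε := by
  have := Measure.isProbabilityMeasure_map hE
  have h1 : P {w | (X w, E w) ∈ B} = P.map (fun w => (X w, E w)) B :=
    (Measure.map_apply_of_aemeasurable (hX.aemeasurable.prodMk hE) hB).symm
  rw [h1, hXE.map_prod_eq_prod_map_map hX.aemeasurable hE, Measure.prod_apply hB,
    lintegral_map (measurable_measure_prodMk_left hB) hX]
  calc ∫⁻ w', P.map E (Prod.mk (X w') ⁻¹' B) ∂P ≤ ∫⁻ _, ε ∂P := by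
        refine lintegral_mono fun w' => ?_
        rw [Measure.map_apply_of_aemeasurable hE (measurable_prodMk_left hB)]
        exact h w'
    _ = ε := by simp

end Concentration

/-! ### Inequalities for `ℓ₁` and `ℓ₂` norms. -/

section Norms

variable {ι m : Type*} [Fintype ι] [Fintype m]

lemma l2norm_nonneg (v : ι → ℝ) : 0 ≤ l2norm v := norm_nonneg _

lemma l2norm_sq (v : ι → ℝ) : l2norm v ^ 2 = ∑ j, v j ^ 2 := by
  simp [l2norm, EuclideanSpace.real_norm_sq_eq]

lemma l2norm_sq_eq_dotProduct (v : ι → ℝ) : l2norm v ^ 2 = v ⬝ᵥ v := by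
  rw [l2norm_sq]
  simp [dotProduct, sq]

lemma l2norm_zero : l2norm (0 : ι → ℝ) = 0 := by simp [l2norm]

lemma eq_zero_of_l2norm_eq_zero {v : ι → ℝ} (h : l2norm v = 0) : v = 0 := by
  simpa [l2norm] using h

lemma l2norm_smul (a : ℝ) (v : ι → ℝ) : l2norm (a • v) = |a| * l2norm v := by
  simp [l2norm, norm_smul]

lemma l2norm_add_le (v w : ι → ℝ) : l2norm (v + w) ≤ l2norm v + l2norm w := by
  simpa [l2norm] using norm_add_le (WithLp.toLp 2 v) (WithLp.toLp 2 w)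

lemma l2norm_sub_le (v w : ι → ℝ) : l2norm (v - w) ≤ l2norm v + l2norm w := by
  simpa [l2norm] using norm_sub_le (WithLp.toLp 2 v) (WithLp.toLp 2 w)

lemma l2norm_le_of_sq_le {v : ι → ℝ} {a : ℝ} (ha : 0 ≤ a) (h : l2norm v ^ 2 ≤ a ^ 2) :
    l2norm v ≤ a := (sq_le_sq₀ (l2norm_nonneg v) ha).1 h

lemma abs_dotProduct_le (v w : ι → ℝ) : |v ⬝ᵥ w| ≤ l2norm v * l2norm w := by
  apply abs_le_of_sq_le_sq _ (mul_nonneg (l2norm_nonneg v) (l2norm_nonneg w))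
  rw [mul_pow, l2norm_sq, l2norm_sq]
  exact Finset.sum_mul_sq_le_sq_mul_sq _ _ _

lemma l1norm_nonneg (v : ι → ℝ) : 0 ≤ l1norm v := Finset.sum_nonneg fun _ _ => abs_nonneg _

lemma abs_dotProduct_le_l1norm_mul {v w : ι → ℝ} {a : ℝ} (h : ∀ j, |w j| ≤ a) :
    |v ⬝ᵥ w| ≤ l1norm v * a := by
  rw [l1norm, Finset.sum_mul]
  refine (Finset.abs_sum_le_sum_abs _ _).trans (Finset.sum_le_sum fun j _ => ?_)
  rw [abs_mul]
  exact mul_le_mul_of_nonneg_left (h j) (abs_nonneg _)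

lemma l2norm_mulVec_le_l1norm_mul (A : Matrix m ι ℝ) (v : ι → ℝ) {a : ℝ}
    (h : ∀ j, v j ≠ 0 → l2norm (fun r => A r j) ≤ a) : l2norm (A.mulVec v) ≤ l1norm v * a := by
  have h1 : A.mulVec v = ∑ j, v j • (fun r => A r j) := by
    ext r
    simp [Matrix.mulVec, dotProduct, mul_comm]
  have h2 : ∀ s : Finset ι, l2norm (∑ j ∈ s, v j • (fun r => A r j)) ≤
      ∑ j ∈ s, l2norm (v j • (fun r => A r j)) := fun s =>
    Finset.le_sum_of_subadditive l2norm l2norm_zero.le l2norm_add_le s _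
  rw [h1, l1norm, Finset.sum_mul]
  refine (h2 _).trans (Finset.sum_le_sum fun j _ => ?_)
  rw [l2norm_smul]
  by_cases hj : v j = 0
  · simp [hj]
  · exact mul_le_mul_of_nonneg_left (h j hj) (abs_nonneg _)

lemma l2norm_single [DecidableEq ι] (j : ι) (a : ℝ) : l2norm (Pi.single j a) = |a| := by
  rw [← abs_of_nonneg (l2norm_nonneg _), ← sq_eq_sq_iff_abs_eq_abs, l2norm_sq]
  simp [Pi.single_apply, ite_pow]

lemma l2norm_le_l1norm (v : ι → ℝ) : l2norm v ≤ l1norm v := by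
  classical
  have := l2norm_mulVec_le_l1norm_mul (1 : Matrix ι ι ℝ) v (a := 1) fun j _ => by
    have h : (fun r => (1 : Matrix ι ι ℝ) r j) = Pi.single j 1 := by
      ext r; simp [Matrix.one_apply, Pi.single_apply]
    rw [h, l2norm_single]
    simp
  simpa using this

omit [Fintype ι] in
lemma sum_abs_le_sqrt_card_mul_l2norm (S : Finset ι) (v : ι → ℝ) :
    ∑ j ∈ S, |v j| ≤ √(S.card : ℝ) * l2norm (fun j : S => v j) := by
  apply le_of_sq_le_sq _ (mul_nonneg (Real.sqrt_nonneg _) (l2norm_nonneg _))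
  rw [mul_pow, Real.sq_sqrt (Nat.cast_nonneg _), l2norm_sq,
    Finset.sum_coe_sort S (fun j => v j ^ 2)]
  refine (sq_sum_le_card_mul_sum_sq).trans_eq ?_
  simp

/-- The squared norm of a vector indexed by pairs is the sum of those of its blocks. -/
lemma l2norm_sq_sigma {ρ : Fin 2 → Type*} [∀ k, Fintype (ρ k)] (v : (k : Fin 2) × ρ k → ℝ) :
    l2norm v ^ 2 = ∑ k, l2norm (fun r => v ⟨k, r⟩) ^ 2 := by
  simp_rw [l2norm_sq]
  rw [Fintype.sum_sigma]

end Norms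

/-! ### Vectors supported on a set of columns, and Gram matrices. -/

section Columns

variable {ι m : Type*} [Fintype ι] [Fintype m] [DecidableEq ι]

/-- The extension by zero of a vector indexed by `M`. -/
def extendZero (M : Finset ι) (δ : M → ℝ) : ι → ℝ := fun l => if h : l ∈ M then δ ⟨l, h⟩ else 0

omit [Fintype ι] in
lemma extendZero_of_notMem {M : Finset ι} (δ : M → ℝ) {l : ι} (h : l ∉ M) :
    extendZero M δ l = 0 := by simp [extendZero, h]

omit [Fintype ι] in
lemma extendZero_restrict {M : Finset ι} {v : ι → ℝ} (h : ∀ l ∉ M, v l = 0) :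
    extendZero M (fun l => v l) = v := by
  ext l
  by_cases hl : l ∈ M
  · simp [extendZero, hl]
  · simp [extendZero, hl, h l hl]

lemma sum_extendZero (M : Finset ι) (δ : M → ℝ) (g : ι → ℝ → ℝ) (hg : ∀ l, g l 0 = 0) :
    ∑ l, g l (extendZero M δ l) = ∑ l : M, g l (δ l) := by
  rw [← Finset.sum_subset (Finset.subset_univ M) fun l _ hl => by
    rw [extendZero_of_notMem δ hl, hg], ← Finset.sum_coe_sort]
  exact Finset.sum_congr rfl fun l _ => by simp [extendZero]

lemma l2norm_extendZero (M : Finset ι) (δ : M → ℝ) : l2norm (extendZero M δ) = l2norm δ := by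
  rw [← sq_eq_sq₀ (l2norm_nonneg _) (l2norm_nonneg _), l2norm_sq, l2norm_sq,
    sum_extendZero M δ (fun _ t => t ^ 2) (by simp)]

omit [Fintype m] in
lemma mulVec_extendZero (X : Matrix m ι ℝ) (M : Finset ι) (δ : M → ℝ) :
    X.mulVec (extendZero M δ) = (colsOn X M).mulVec δ := by
  ext r
  exact sum_extendZero M δ (fun l t => X r l * t) (by simp)

omit [Fintype m] in
lemma colsOn_mulVec_restrict (X : Matrix m ι ℝ) {M : Finset ι} {v : ι → ℝ}
    (h : ∀ l ∉ M, v l = 0) : (colsOn X M).mulVec (fun l => v l) = X.mulVec v := by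
  rw [← mulVec_extendZero, extendZero_restrict h]

lemma l2norm_restrict {M : Finset ι} {v : ι → ℝ} (h : ∀ l ∉ M, v l = 0) :
    l2norm (fun l : M => v l) = l2norm v := by
  rw [← l2norm_extendZero, extendZero_restrict h]

omit [DecidableEq ι] in
lemma dotProduct_gram_mulVec (X : Matrix m ι ℝ) (v : ι → ℝ) :
    v ⬝ᵥ (X.transpose * X).mulVec v = l2norm (X.mulVec v) ^ 2 := by
  rw [l2norm_sq_eq_dotProduct, ← Matrix.mulVec_mulVec, Matrix.dotProduct_mulVec,
    Matrix.vecMul_transpose]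

/-- If the matrix kills `v`, pairing with `v` gives `‖X v‖² + lam ‖v‖² = 0`; hence `X v = 0`, and
the lower bound on `X` forces `v = 0`. This also works for `lam = 0`. -/
lemma isUnit_det_gram_add_smul {X : Matrix m ι ℝ} {a lam : ℝ} (ha : 0 < a) (hlam : 0 ≤ lam)
    (h : ∀ v, a * l2norm v ≤ l2norm (X.mulVec v)) :
    IsUnit (X.transpose * X + lam • (1 : Matrix ι ι ℝ)).det := by
  rw [← Matrix.isUnit_iff_isUnit_det, ← Matrix.mulVec_injective_iff_isUnit]
  rw [← Matrix.coe_mulVecLin, ← LinearMap.ker_eq_bot, LinearMap.ker_eq_bot']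
  intro v hv
  have h0 : v ⬝ᵥ (X.transpose * X + lam • (1 : Matrix ι ι ℝ)).mulVec v = 0 := by
    rw [Matrix.mulVecLin_apply] at hv
    rw [hv, dotProduct_zero]
  rw [Matrix.add_mulVec, dotProduct_add, dotProduct_gram_mulVec, Matrix.smul_mulVec,
    Matrix.one_mulVec, dotProduct_smul, ← l2norm_sq_eq_dotProduct, smul_eq_mul] at h0
  have h1 := h v
  have h2 := l2norm_nonneg v
  apply eq_zero_of_l2norm_eq_zero
  have h3 : l2norm (X.mulVec v) = 0 := by
    have : 0 ≤ lam * l2norm v ^ 2 := by positivity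
    have : l2norm (X.mulVec v) ^ 2 = 0 := le_antisymm (by linarith) (sq_nonneg _)
    simpa using this
  rw [h3] at h1
  nlinarith

lemma isUnit_det_gram {X : Matrix m ι ℝ} {a : ℝ} (ha : 0 < a)
    (h : ∀ v, a * l2norm v ≤ l2norm (X.mulVec v)) : IsUnit (X.transpose * X).det := by
  simpa using isUnit_det_gram_add_smul ha le_rfl h

end Columns

/-! ### The projection off a set of columns. -/

section Projection

variable {ι m : Type*} [Fintype ι] [Fintype m] [DecidableEq ι] [DecidableEq m]
  {X : Matrix m ι ℝ} {A : Finset ι}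

omit [Fintype ι] in
lemma projOff_transpose : (projOff X A).transpose = projOff X A := by
  simp [projOff, Matrix.transpose_nonsing_inv, Matrix.mul_assoc]

omit [Fintype ι] in
-- Invertibility of the Gram matrix matters: a singular matrix has inverse `0` by convention, and
-- `projOff` would then be the identity.
lemma projOff_mul_colsOn (h : IsUnit ((colsOn X A).transpose * colsOn X A).det) :
    projOff X A * colsOn X A = 0 := by
  rw [projOff, Matrix.sub_mul, Matrix.one_mul, Matrix.mul_assoc, Matrix.mul_assoc,
    Matrix.nonsing_inv_mul _ h, Matrix.mul_one, sub_self]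

omit [Fintype ι] in
lemma projOff_mul_self (h : IsUnit ((colsOn X A).transpose * colsOn X A).det) :
    projOff X A * projOff X A = projOff X A := by
  conv_lhs => rw [projOff.eq_1 X A, Matrix.mul_sub, ← projOff.eq_1 X A]
  rw [← Matrix.mul_assoc, ← Matrix.mul_assoc, projOff_mul_colsOn h]
  simp

lemma projOff_mulVec_of_support (h : IsUnit ((colsOn X A).transpose * colsOn X A).det)
    {v : ι → ℝ} (hv : ∀ l ∉ A, v l = 0) : (projOff X A).mulVec (X.mulVec v) = 0 := by
  rw [← colsOn_mulVec_restrict X hv, Matrix.mulVec_mulVec, projOff_mul_colsOn h,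
    Matrix.zero_mulVec]

omit [Fintype ι] in
-- A symmetric idempotent `H` satisfies `‖H v‖² = ⟨v, H v⟩ ≤ ‖v‖ ‖H v‖`.
lemma l2norm_projOff_le (h : IsUnit ((colsOn X A).transpose * colsOn X A).det) (v : m → ℝ) :
    l2norm ((projOff X A).mulVec v) ≤ l2norm v := by
  have h1 : l2norm ((projOff X A).mulVec v) ^ 2 = v ⬝ᵥ (projOff X A).mulVec v := by
    rw [← dotProduct_gram_mulVec, projOff_transpose, projOff_mul_self h]
  have h2 := (le_abs_self _).trans (abs_dotProduct_le v ((projOff X A).mulVec v))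
  rw [← h1] at h2
  rcases (l2norm_nonneg ((projOff X A).mulVec v)).eq_or_lt with h0 | h0
  · rw [← h0]
    exact l2norm_nonneg v
  · nlinarith

end Projection

/-! ### Deterministic error of the ridge estimate. -/

section Ridge

variable {ι m : Type*} [Fintype ι] [Fintype m] [DecidableEq ι]

omit [Fintype ι] in
lemma ridge_of_notMem (X : Matrix m ι ℝ) {M : Finset ι} (lam : ℝ) (y : m → ℝ) {l : ι}
    (h : l ∉ M) : ridge X M lam y l = 0 := by simp [ridge, h]

/-- The error `u` on `M` solves `(X_Mᵀ X_M + lam) u = X_Mᵀ ξ - lam π`, the last term being the ridge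
bias. Pairing with `u`, the left side is at least `a² ‖u‖²`; Cauchy-Schwarz on the right and
division by `‖u‖` finish. -/
lemma l2norm_ridge_sub_le {X : Matrix m ι ℝ} {M : Finset ι} {lam a : ℝ} (ha : 0 < a)
    (hlam : 0 ≤ lam) (h : ∀ v : ι → ℝ, (∀ l ∉ M, v l = 0) → a * l2norm v ≤ l2norm (X.mulVec v))
    {π : ι → ℝ} (hπ : ∀ l ∉ M, π l = 0) (ξ : m → ℝ) :
    a ^ 2 * l2norm (ridge X M lam (X.mulVec π + ξ) - π) ≤
      l2norm ((colsOn X M).transpose.mulVec ξ) + lam * l2norm π := by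
  set XM := colsOn X M with hXM
  set G : Matrix M M ℝ := XM.transpose * XM + lam • (1 : Matrix M M ℝ) with hG
  have hlow : ∀ v, a * l2norm v ≤ l2norm (XM.mulVec v) := fun v => by
    rw [← mulVec_extendZero, ← l2norm_extendZero]
    exact h _ fun l hl => extendZero_of_notMem v hl
  have hdet : IsUnit G.det := isUnit_det_gram_add_smul ha hlam hlow
  set πM : M → ℝ := fun l => π l with hπM
  set u : M → ℝ := G⁻¹.mulVec (XM.transpose.mulVec (X.mulVec π + ξ)) - πM with hu
  have he : ridge X M lam (X.mulVec π + ξ) - π = extendZero M u := by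
    ext l
    by_cases hl : l ∈ M
    · simp [ridge, extendZero, hl, hu, hG, hXM, hπM]
    · simp [ridge, extendZero, hl, hπ l hl]
  have hGu : G.mulVec u = XM.transpose.mulVec ξ - lam • πM := by
    have h1 : X.mulVec π = XM.mulVec πM := (colsOn_mulVec_restrict X hπ).symm
    rw [hu, Matrix.mulVec_sub, Matrix.mulVec_mulVec, Matrix.mul_nonsing_inv _ hdet,
      Matrix.one_mulVec, h1, hG, Matrix.add_mulVec, Matrix.smul_mulVec, Matrix.one_mulVec,
      Matrix.mulVec_add, Matrix.mulVec_mulVec]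
    abel
  have hquad : a ^ 2 * l2norm u ^ 2 ≤ u ⬝ᵥ G.mulVec u := by
    rw [hG, Matrix.add_mulVec, dotProduct_add, dotProduct_gram_mulVec, Matrix.smul_mulVec,
      Matrix.one_mulVec, dotProduct_smul, ← l2norm_sq_eq_dotProduct, smul_eq_mul, ← mul_pow]
    have h1 := pow_le_pow_left₀ (mul_nonneg ha.le (l2norm_nonneg u)) (hlow u) 2
    have : 0 ≤ lam * l2norm u ^ 2 := by positivity
    linarith
  have hcs := (le_abs_self _).trans (abs_dotProduct_le u (G.mulVec u))
  have hR : l2norm (G.mulVec u) ≤ l2norm (XM.transpose.mulVec ξ) + lam * l2norm π := by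
    rw [hGu]
    refine (l2norm_sub_le _ _).trans_eq ?_
    rw [l2norm_smul, abs_of_nonneg hlam, l2norm_restrict hπ]
  rw [he, l2norm_extendZero]
  refine le_trans ?_ hR
  rcases (l2norm_nonneg u).eq_or_lt with h0 | h0
  · rw [← h0, mul_zero]
    exact l2norm_nonneg _
  · nlinarith

end Ridge

/-! ### Deterministic analysis of the weighted lasso. -/

section Lasso

variable {ι m : Type*} [Fintype ι] [Fintype m] [DecidableEq ι]

/-- Comparing the objective at `b` and at `β` leaves the cross term `(2 / n) ⟨Aᵀ η, u⟩`. The factor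
`4` in the noise condition makes it at most half of the weighted penalty of `u`, so half of the
penalty off `S` survives on the left. -/
lemma lasso_basic_inequality {A : Matrix m ι ℝ} {y : m → ℝ} {β b ω : ι → ℝ} {n lam : ℝ}
    (hn : 0 < n) {S : Finset ι} (hβ : ∀ j ∉ S, β j = 0) (hω : ∀ j, 0 ≤ ω j) (hlam : 0 ≤ lam)
    (hmin : 1 / n * l2norm (y - A.mulVec b) ^ 2 + lam * ∑ j, ω j * |b j| ≤
      1 / n * l2norm (y - A.mulVec β) ^ 2 + lam * ∑ j, ω j * |β j|)
    (hnoise : ∀ j, 4 / n * |A.transpose.mulVec (y - A.mulVec β) j| ≤ lam * ω j) :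
    1 / n * l2norm (A.mulVec (b - β)) ^ 2 + lam / 2 * ∑ j ∈ Sᶜ, ω j * |(b - β) j| ≤
      3 / 2 * lam * ∑ j ∈ S, ω j * |(b - β) j| := by
  set u := b - β with hu
  set η := y - A.mulVec β with hη
  have h1 : y - A.mulVec b = η - A.mulVec u := by
    rw [hη, hu, Matrix.mulVec_sub]; abel
  have h2 : l2norm (η - A.mulVec u) ^ 2 =
      l2norm η ^ 2 - 2 * (A.transpose.mulVec η ⬝ᵥ u) + l2norm (A.mulVec u) ^ 2 := by
    rw [Matrix.mulVec_transpose, ← Matrix.dotProduct_mulVec]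
    simp only [l2norm_sq_eq_dotProduct, sub_dotProduct, dotProduct_sub,
      dotProduct_comm (A.mulVec u) η]
    ring
  have h3 : 2 / n * (A.transpose.mulVec η ⬝ᵥ u) ≤ lam / 2 * ∑ j, ω j * |u j| := by
    rw [dotProduct, Finset.mul_sum, Finset.mul_sum]
    refine Finset.sum_le_sum fun j _ => ?_
    have := mul_le_mul_of_nonneg_right (hnoise j) (abs_nonneg (u j))
    have h4 := le_abs_self (A.transpose.mulVec η j * u j)
    rw [abs_mul] at h4
    have h5 := mul_le_mul_of_nonneg_left h4 (show 0 ≤ 2 / n by positivity)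
    have h6 : 4 / n = 2 * (2 / n) := by ring
    rw [h6] at this
    linarith
  -- On `S` this is the triangle inequality; off `S`, where `β` vanishes, `b` and `u` coincide.
  have h4 : ∑ j, ω j * |β j| - ∑ j, ω j * |b j| ≤
      ∑ j ∈ S, ω j * |u j| - ∑ j ∈ Sᶜ, ω j * |u j| := by
    rw [← Finset.sum_add_sum_compl S, ← Finset.sum_add_sum_compl S fun j => ω j * |b j|]
    have hS : ∑ j ∈ S, ω j * |β j| ≤ ∑ j ∈ S, ω j * |u j| + ∑ j ∈ S, ω j * |b j| := by
      rw [← Finset.sum_add_distrib]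
      refine Finset.sum_le_sum fun j _ => ?_
      rw [← mul_add]
      refine mul_le_mul_of_nonneg_left ?_ (hω j)
      have := abs_sub_abs_le_abs_sub (β j) (b j)
      rw [abs_sub_comm] at this
      simp only [hu, Pi.sub_apply]
      linarith
    have hS1 : ∑ j ∈ Sᶜ, ω j * |β j| = 0 := Finset.sum_eq_zero fun j hj => by
      rw [hβ j (by simpa using hj)]; simp
    have hS2 : ∑ j ∈ Sᶜ, ω j * |u j| = ∑ j ∈ Sᶜ, ω j * |b j| :=
      Finset.sum_congr rfl fun j hj => by
        rw [hu, Pi.sub_apply, hβ j (by simpa using hj), sub_zero]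
    linarith
  have h5 := mul_le_mul_of_nonneg_left h4 hlam
  have h6 := Finset.sum_add_sum_compl S fun j => ω j * |u j|
  rw [h1, h2] at hmin
  rw [← h6] at h3
  have h7 : 1 / n * (l2norm η ^ 2 - 2 * (A.transpose.mulVec η ⬝ᵥ u) + l2norm (A.mulVec u) ^ 2) =
      1 / n * l2norm η ^ 2 - 2 / n * (A.transpose.mulVec η ⬝ᵥ u)
        + 1 / n * l2norm (A.mulVec u) ^ 2 := by ring
  rw [h7] at hmin
  linarith

/-- The error bounds of the weighted lasso under a restricted eigenvalue condition. -/
lemma lasso_error_bounds {A : Matrix m ι ℝ} {u ω : ι → ℝ} {n lam φ W : ℝ}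
    (hn : 0 < n) (hlam : 0 < lam) (hφ : 0 < φ) (hW : 0 < W) {S : Finset ι}
    (hS : ∀ j ∈ S, ω j ≤ W) (hSc : ∀ j ∉ S, W ≤ ω j)
    (hbasic : 1 / n * l2norm (A.mulVec u) ^ 2 + lam / 2 * ∑ j ∈ Sᶜ, ω j * |u j| ≤
      3 / 2 * lam * ∑ j ∈ S, ω j * |u j|)
    (hre : ∑ j ∈ Sᶜ, |u j| ≤ 3 * ∑ j ∈ S, |u j| →
      φ / 2 * (√n * l2norm fun j : S => u j) ≤ l2norm (A.mulVec u)) :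
    l1norm u ≤ 24 * S.card * (lam * W / φ ^ 2) ∧
      1 / n * l2norm (A.mulVec u) ^ 2 ≤ 9 * S.card * (lam ^ 2 * W ^ 2 / φ ^ 2) := by
  set N := l2norm (A.mulVec u) with hN
  set U := l2norm fun j : S => u j with hU
  set L := ∑ j ∈ S, |u j| with hL
  set s := √(S.card : ℝ) with hs
  have hN0 : 0 ≤ N := l2norm_nonneg _
  have hU0 : 0 ≤ U := l2norm_nonneg _
  have hs0 : 0 ≤ s := Real.sqrt_nonneg _
  have hss : s ^ 2 = S.card := Real.sq_sqrt (Nat.cast_nonneg _)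
  have hLU : L ≤ s * U := sum_abs_le_sqrt_card_mul_l2norm S u
  have h1 : ∑ j ∈ S, ω j * |u j| ≤ W * L := by
    rw [hL, Finset.mul_sum]
    exact Finset.sum_le_sum fun j hj => mul_le_mul_of_nonneg_right (hS j hj) (abs_nonneg _)
  have h2 : W * ∑ j ∈ Sᶜ, |u j| ≤ ∑ j ∈ Sᶜ, ω j * |u j| := by
    rw [Finset.mul_sum]
    exact Finset.sum_le_sum fun j hj =>
      mul_le_mul_of_nonneg_right (hSc j (by simpa using hj)) (abs_nonneg _)
  have hn1 : 0 ≤ 1 / n * N ^ 2 := by positivity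
  have hSc0 : 0 ≤ W * ∑ j ∈ Sᶜ, |u j| :=
    mul_nonneg hW.le (Finset.sum_nonneg fun _ _ => abs_nonneg _)
  have h1' := mul_le_mul_of_nonneg_left h1 (show 0 ≤ 3 / 2 * lam by positivity)
  have h2' := mul_le_mul_of_nonneg_left h2 (show 0 ≤ lam / 2 by positivity)
  -- Since the weights are at most `W` on `S` and at least `W` off `S`, the weighted inequality
  -- becomes the unweighted cone condition; `3` is the ratio of `3 / 2` to `1 / 2`.
  have hcone : ∑ j ∈ Sᶜ, |u j| ≤ 3 * L := by
    have : (lam / 2 * W) * ∑ j ∈ Sᶜ, |u j| ≤ (lam / 2 * W) * (3 * L) := by nlinarith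
    exact le_of_mul_le_mul_left this (by positivity)
  have hre' := hre hcone
  have hn0 : 0 < √n := Real.sqrt_pos.2 hn
  have hnn : √n ^ 2 = n := Real.sq_sqrt hn.le
  have hUN : U ≤ 2 * N / (φ * √n) := by
    rw [le_div_iff₀ (by positivity)]; linarith
  have hmain : 1 / n * N ^ 2 ≤ 3 / 2 * lam * (W * (s * U)) := by
    have : 3 / 2 * lam * (W * L) ≤ 3 / 2 * lam * (W * (s * U)) := by gcongr
    have : 0 ≤ lam / 2 * (W * ∑ j ∈ Sᶜ, |u j|) := by positivity
    linarith
  -- The inequality is self-bounding: `N²` is controlled by `U`, hence by `N` itself through the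
  -- restricted eigenvalue, and one factor `N` cancels.
  have hNb : N ≤ 3 * lam * W * s * √n / φ := by
    rcases hN0.eq_or_lt with h0 | h0
    · rw [← h0]; positivity
    · have h3 : 1 / n * N ^ 2 ≤ 3 / 2 * lam * (W * (s * (2 * N / (φ * √n)))) :=
        hmain.trans (by gcongr)
      have h4 : 1 / n * N ^ 2 = N / √n ^ 2 * N := by rw [hnn]; ring
      have h5 : 3 / 2 * lam * (W * (s * (2 * N / (φ * √n)))) =
          3 * lam * W * s / (φ * √n) * N := by ring
      rw [h4, h5] at h3
      have h6 := le_of_mul_le_mul_right h3 h0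
      rw [div_le_iff₀ (by positivity)] at h6
      refine h6.trans_eq ?_
      field_simp
  constructor
  -- The constant `24` is `4 · 2 · 3`: the cone, the halved eigenvalue, and the bound on `N`.
  · have h3 : l1norm u ≤ 4 * L := by
      have := Finset.sum_add_sum_compl S fun j => |u j|
      rw [l1norm, ← this]
      linarith
    calc l1norm u ≤ 4 * (s * (2 * (3 * lam * W * s * √n / φ) / (φ * √n))) := by
          refine h3.trans ?_
          gcongr
          refine hLU.trans ?_
          gcongr
          refine hUN.trans ?_
          gcongr
      _ = 24 * s ^ 2 * (lam * W / φ ^ 2) := by field_simp; ring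
      _ = _ := by rw [hss]
  · calc 1 / n * N ^ 2 ≤ 1 / n * (3 * lam * W * s * √n / φ) ^ 2 := by gcongr
      _ = 9 * s ^ 2 * (lam ^ 2 * W ^ 2 / φ ^ 2) := by
          rw [div_pow, mul_pow _ (√n), hnn]; field_simp; ring
      _ = _ := by rw [hss]

end Lasso

/-! ### Lower and upper bounds by scaling, and the support of `(1 - Γ)⁻¹`. -/

section Reduced

variable {ι m : Type*} [Fintype ι] [Fintype m]

lemma mul_l2norm_le_of_unit {A : Matrix m ι ℝ} {a : ℝ}
    (h : ∀ v, l2norm v = 1 → a ≤ l2norm (A.mulVec v)) (v : ι → ℝ) :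
    a * l2norm v ≤ l2norm (A.mulVec v) := by
  rcases (l2norm_nonneg v).eq_or_lt with h0 | h0
  · rw [← h0, mul_zero]; exact l2norm_nonneg _
  · have h1 := h ((l2norm v)⁻¹ • v) (by
      rw [l2norm_smul, abs_of_pos (inv_pos.2 h0), inv_mul_cancel₀ h0.ne'])
    rw [Matrix.mulVec_smul, l2norm_smul, abs_of_pos (inv_pos.2 h0), inv_mul_eq_div,
      le_div_iff₀ h0] at h1
    exact h1

lemma l2norm_mulVec_le_of_unit {A : Matrix m ι ℝ} {a : ℝ}
    (h : ∀ v, l2norm v = 1 → l2norm (A.mulVec v) ≤ a) (v : ι → ℝ) :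
    l2norm (A.mulVec v) ≤ a * l2norm v := by
  rcases (l2norm_nonneg v).eq_or_lt with h0 | h0
  · rw [eq_zero_of_l2norm_eq_zero h0.symm, Matrix.mulVec_zero, l2norm_zero, l2norm_zero, mul_zero]
  · have h1 := h ((l2norm v)⁻¹ • v) (by
      rw [l2norm_smul, abs_of_pos (inv_pos.2 h0), inv_mul_cancel₀ h0.ne'])
    rw [Matrix.mulVec_smul, l2norm_smul, abs_of_pos (inv_pos.2 h0), inv_mul_eq_div,
      div_le_iff₀ h0] at h1
    exact h1

/-- The entry `(j, i)` of `(1 - Γ)⁻¹` vanishes unless `j = i` or `j` regulates `i`. -/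
lemma eq_or_regulates_of_inv_ne_zero {p : ℕ} {Γ : Matrix (Fin p) (Fin p) ℝ}
    (hdet : IsUnit (1 - Γ).det) {i j : Fin p} (h : (1 - Γ)⁻¹ j i ≠ 0) :
    j = i ∨ Regulates Γ j i := by
  -- The vectors supported on `i` and its regulators form a subspace invariant under `1 - Γ`. An
  -- injective map of a finite-dimensional space is onto, so the preimage of `e_i` lies in `W`; it
  -- is column `i` of the inverse. No Neumann series is used, so cycles and large entries of `Γ` do
  -- no harm.
  let W : Submodule ℝ (Fin p → ℝ) :=
    { carrier := {v | ∀ a, ¬ (a = i ∨ Regulates Γ a i) → v a = 0}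
      add_mem' := fun hv hw a ha => by simp [hv a ha, hw a ha]
      zero_mem' := fun a _ => rfl
      smul_mem' := fun t v hv a ha => by simp [hv a ha] }
  have hmaps : ∀ v ∈ W, (1 - Γ).mulVecLin v ∈ W := by
    intro v hv a ha
    rw [Matrix.mulVecLin_apply, Matrix.sub_mulVec, Matrix.one_mulVec, Pi.sub_apply, hv a ha,
      zero_sub, neg_eq_zero, Matrix.mulVec, dotProduct]
    refine Finset.sum_eq_zero fun b _ => ?_
    by_cases hb : b = i ∨ Regulates Γ b i
    · have : Γ a b = 0 := by
        by_contra hab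
        refine ha (Or.inr ?_)
        rcases hb with rfl | hb
        · exact Relation.TransGen.single hab
        · exact Relation.TransGen.head hab hb
      rw [this, zero_mul]
    · rw [hv b hb, mul_zero]
  have hinj : Function.Injective (1 - Γ).mulVecLin :=
    Matrix.mulVec_injective_iff_isUnit.2 ((Matrix.isUnit_iff_isUnit_det _).2 hdet)
  have hinj' : Function.Injective ((1 - Γ).mulVecLin.restrict hmaps) := fun v w hvw =>
    Subtype.ext (hinj (congrArg Subtype.val hvw))
  have hsurj := LinearMap.injective_iff_surjective.1 hinj'
  have hei : (Pi.single i 1 : Fin p → ℝ) ∈ W := fun a ha => by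
    have : a ≠ i := fun h => ha (Or.inl h)
    simp [this]
  obtain ⟨⟨v, hvW⟩, hv⟩ := hsurj ⟨_, hei⟩
  have hv' : (1 - Γ).mulVec v = Pi.single i 1 := congrArg Subtype.val hv
  have hcol : (1 - Γ)⁻¹ j i = v j := by
    have h1 := congrArg ((1 - Γ)⁻¹).mulVec hv'
    rw [Matrix.mulVec_mulVec, Matrix.nonsing_inv_mul _ hdet, Matrix.one_mulVec] at h1
    rw [h1]
    simp
  by_contra hj
  exact h (hcol.trans (hvW j hj))

end Reduced

/-! ### Reduced form of the model and the calibration error. -/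

namespace Setting

variable {Ω : Type*} [MeasurableSpace Ω] {P : Measure Ω} {K : ModelConstants} (S : Setting P K)

lemma singular_ge_mul (k : Fin 2) (v : Fin S.p → ℝ) :
    K.c * l2norm v ≤ l2norm ((1 - S.Γ k).mulVec v) :=
  mul_l2norm_le_of_unit (S.singular_ge k) v

lemma isUnit_det (k : Fin 2) : IsUnit (1 - S.Γ k).det := by
  have := isUnit_det_gram K.c_pos (S.singular_ge_mul k)
  rw [Matrix.det_mul] at this
  exact isUnit_of_mul_isUnit_right this

/-- The coefficients of the errors in the reduced form have norm at most `1 / c`. -/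
lemma l2norm_inv_col_le (k : Fin 2) (i : Fin S.p) :
    l2norm (fun j => (1 - S.Γ k)⁻¹ j i) ≤ 1 / K.c := by
  have h := S.singular_ge_mul k (fun j => (1 - S.Γ k)⁻¹ j i)
  have h1 : (1 - S.Γ k).mulVec (fun j => (1 - S.Γ k)⁻¹ j i) = Pi.single i 1 := by
    ext a
    have h2 := congrFun (congrFun (Matrix.mul_nonsing_inv _ (S.isUnit_det k)) a) i
    rw [Matrix.mul_apply] at h2
    rw [Matrix.mulVec, dotProduct, h2]
    simp [Matrix.one_apply, Pi.single_apply]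
  rw [h1, l2norm_single, abs_one] at h
  rw [le_div_iff₀ K.c_pos]
  linarith

/-- The errors `E (I - Γ)⁻¹` of the reduced form. -/
noncomputable def noise (w : Ω) (k : Fin 2) : Matrix (Fin (S.n k)) (Fin S.p) ℝ :=
  S.E w k * (1 - S.Γ k)⁻¹

lemma reduced_form (w : Ω) (k : Fin 2) : S.Y w k = S.X w k * S.coef k + S.noise w k := by
  have h : S.Y w k * (1 - S.Γ k) = S.X w k * S.Φ k + S.E w k := by
    have := S.sem w k
    rw [Matrix.mul_sub, Matrix.mul_one]
    nth_rewrite 1 [this]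
    abel
  have h1 := congrArg (· * (1 - S.Γ k)⁻¹) h
  simp only [Matrix.mul_assoc, Matrix.mul_nonsing_inv _ (S.isUnit_det k), Matrix.mul_one,
    Matrix.add_mul] at h1
  exact h1

lemma reduced_form_col (w : Ω) (k : Fin 2) (i : Fin S.p) :
    (fun r => S.Y w k r i) =
      (S.X w k).mulVec (fun l => S.coef k l i) + fun r => S.noise w k r i := by
  ext r
  rw [S.reduced_form w k]
  rfl

/-- This splits column `i` of `π` into the anchoring effects, which the projection removes, and the
combination of the other columns that the construction stage fits. -/
lemma coef_eq (k : Fin 2) : S.coef k = S.Φ k + S.coef k * S.Γ k := by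
  have h : S.coef k * (1 - S.Γ k) = S.Φ k := by
    rw [coef, reducedCoef, Matrix.mul_assoc, Matrix.nonsing_inv_mul _ (S.isUnit_det k),
      Matrix.mul_one]
  rw [← h, Matrix.mul_sub, Matrix.mul_one]
  simp

/-- A nonzero term `Φ l j (1 - Γ)⁻¹ j i` means that `l` anchors `j` and that `j` is `i` or regulates
it; screening puts such an `l` into `M k i`. -/
lemma coef_eq_zero {k : Fin 2} {i : Fin S.p} {l : Fin S.q} (h : l ∉ S.M k i) :
    S.coef k l i = 0 := by
  rw [coef, reducedCoef, Matrix.mul_apply]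
  refine Finset.sum_eq_zero fun j _ => ?_
  by_contra hne
  have h1 := left_ne_zero_of_mul hne
  have h2 := right_ne_zero_of_mul hne
  refine h (S.screening k i ⟨j, eq_or_regulates_of_inv_ne_zero (S.isUnit_det k) h2, ?_⟩)
  simpa [anchors, supp] using h1

lemma anchors_subset (k : Fin 2) (i : Fin S.p) : anchors (S.Φ k) i ⊆ S.M k i := fun _ hl =>
  S.screening k i ⟨i, Or.inl rfl, hl⟩

lemma sqrt_n_pos (k : Fin 2) : 0 < √(S.n k : ℝ) :=
  Real.sqrt_pos.2 (Nat.cast_pos.2 (S.n_pos k))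

lemma l2norm_mulVec_le (w : Ω) (k : Fin 2) (i : Fin S.p) {v : Fin S.q → ℝ}
    (hv : ∀ l ∉ S.M k i, v l = 0) :
    l2norm ((S.X w k).mulVec v) ≤ K.c₁ k * √(S.n k : ℝ) * l2norm v := by
  rw [← colsOn_mulVec_restrict _ hv, ← l2norm_restrict hv]
  refine l2norm_mulVec_le_of_unit (fun δ hδ => ?_) _
  have := S.design_le w k i δ hδ
  rwa [inv_mul_le_iff₀ (S.sqrt_n_pos k), mul_comm] at this

lemma le_l2norm_mulVec (w : Ω) (k : Fin 2) (i : Fin S.p) {v : Fin S.q → ℝ}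
    (hv : ∀ l ∉ S.M k i, v l = 0) :
    K.c₂ k * √(S.n k : ℝ) * l2norm v ≤ l2norm ((S.X w k).mulVec v) := by
  rw [← colsOn_mulVec_restrict _ hv, ← l2norm_restrict hv]
  refine mul_l2norm_le_of_unit (fun δ hδ => ?_) _
  have := S.design_ge w k i δ hδ
  rwa [le_inv_mul_iff₀ (S.sqrt_n_pos k), mul_comm] at this

lemma isUnit_det_gram_anchors (w : Ω) (k : Fin 2) (i : Fin S.p) :
    IsUnit ((colsOn (S.X w k) (anchors (S.Φ k) i)).transpose *
      colsOn (S.X w k) (anchors (S.Φ k) i)).det := by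
  refine isUnit_det_gram (a := K.c₂ k * √(S.n k : ℝ)) (mul_pos (K.c₂_pos k) (S.sqrt_n_pos k))
    fun δ => ?_
  rw [← mulVec_extendZero, ← l2norm_extendZero]
  exact S.le_l2norm_mulVec w k i fun l hl =>
    extendZero_of_notMem δ fun h => hl (S.anchors_subset k i h)

/-- The projection `H_i⁽ᵏ⁾`. -/
noncomputable def proj (w : Ω) (k : Fin 2) (i : Fin S.p) :
    Matrix (Fin (S.n k)) (Fin (S.n k)) ℝ := projOff (S.X w k) (anchors (S.Φ k) i)

lemma l2norm_proj_le (w : Ω) (k : Fin 2) (i : Fin S.p) (v : Fin (S.n k) → ℝ) :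
    l2norm ((S.proj w k i).mulVec v) ≤ l2norm v :=
  l2norm_projOff_le (S.isUnit_det_gram_anchors w k i) v

lemma proj_transpose (w : Ω) (k : Fin 2) (i : Fin S.p) :
    (S.proj w k i).transpose = S.proj w k i := projOff_transpose

lemma proj_mul_self (w : Ω) (k : Fin 2) (i : Fin S.p) :
    S.proj w k i * S.proj w k i = S.proj w k i :=
  projOff_mul_self (S.isUnit_det_gram_anchors w k i)

/-- The estimation error of the `i`-th column in the calibration stage. -/
noncomputable def dev (w : Ω) (k : Fin 2) (i : Fin S.p) : Fin S.q → ℝ :=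
  fun l => S.coefHat w k l i - S.coef k l i

lemma dev_eq_zero (w : Ω) {k : Fin 2} {i : Fin S.p} {l : Fin S.q} (h : l ∉ S.M k i) :
    S.dev w k i l = 0 := by
  rw [dev, S.coef_eq_zero h, sub_zero]
  exact ridge_of_notMem _ _ _ h

/-- The score `X_Mᵀ ε` of the `i`-th column in the calibration stage. -/
noncomputable def score (w : Ω) (k : Fin 2) (i : Fin S.p) : S.M k i → ℝ :=
  (colsOn (S.X w k) (S.M k i)).transpose.mulVec fun r => S.noise w k r i

lemma l2norm_dev_le (w : Ω) (k : Fin 2) (i : Fin S.p) :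
    K.c₂ k ^ 2 * S.n k * l2norm (S.dev w k i) ≤
      l2norm (S.score w k i) + S.ridgeParam k i * l2norm (fun l => S.coef k l i) := by
  have h := l2norm_ridge_sub_le (X := S.X w k) (M := S.M k i)
    (mul_pos (K.c₂_pos k) (S.sqrt_n_pos k)) (S.ridgeParam_nonneg k i)
    (fun v hv => S.le_l2norm_mulVec w k i hv) (π := fun l => S.coef k l i)
    (fun l hl => S.coef_eq_zero hl) (fun r => S.noise w k r i)
  rw [mul_pow, Real.sq_sqrt (Nat.cast_nonneg _), ← S.reduced_form_col] at h
  exact h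

lemma d_le_R : (S.d : ℝ) ≤ S.R := le_max_left _ _

lemma R_nonneg : 0 ≤ S.R := (Nat.cast_nonneg _).trans S.d_le_R

lemma f_le_R (k : Fin 2) : S.f k ≤ S.R := by
  refine le_trans ?_ ((le_max_right _ _).trans (le_max_right _ _))
  rw [fMax]
  fin_cases k
  · exact le_max_left _ _
  · exact le_max_right _ _

lemma r_le_R (k : Fin 2) (i : Fin S.p) : S.r k i ≤ S.R := by
  refine le_trans ?_ ((le_max_left _ _).trans (le_max_right _ _))
  refine le_trans ?_ (le_ciSup (f := fun i => max (S.r 0 i) (S.r 1 i))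
    (Set.finite_range _).bddAbove i)
  fin_cases k
  · exact le_max_left _ _
  · exact le_max_right _ _

/-- The variance proxy of the score. -/
noncomputable def scoreProxy (k : Fin 2) : ℝ := (K.σmax / K.c) ^ 2 * (K.c₁ k ^ 2 * S.n k)

lemma scoreProxy_pos (k : Fin 2) : 0 < S.scoreProxy k := by
  have := K.σmax_pos
  have := K.c_pos
  have := K.c₁_pos k
  have : (0 : ℝ) < S.n k := Nat.cast_pos.2 (S.n_pos k)
  rw [scoreProxy]
  positivity

end Setting

/-- The constant of the calibration bound of network `k`. -/
noncomputable def ModelConstants.calib (K : ModelConstants) (k : Fin 2) : ℝ :=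
  2 * K.c₁ k ^ 2 / K.c₂ k ^ 4 * (8 * ((K.σmax / K.c) ^ 2 * K.c₁ k ^ 2) + 1)

lemma ModelConstants.calib_pos (K : ModelConstants) (k : Fin 2) : 0 < K.calib k := by
  have := K.c₁_pos k
  have := K.c₂_pos k
  rw [calib]
  positivity

namespace Setting

variable {Ω : Type*} [MeasurableSpace Ω] {P : Measure Ω} {K : ModelConstants} (S : Setting P K)

/-- The event on which the scores of column `i` in network `k` are controlled. -/
def ScoreBound (w : Ω) (k : Fin 2) (i : Fin S.p) : Prop :=
  l2norm (S.score w k i) ^ 2 ≤ 8 * S.scoreProxy k * S.R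

/-- The squared score is of order `n R` by hypothesis, and the squared ridge bias is at most `n R`
by the definition of `r`. Dividing by the lower design bound, of order `n`, and multiplying by the
upper one, of order `√n`, makes all powers of `n` cancel after squaring. -/
lemma l2norm_mulVec_dev_sq_le {w : Ω} {k : Fin 2} {i : Fin S.p} (h : S.ScoreBound w k i) :
    l2norm ((S.X w k).mulVec (S.dev w k i)) ^ 2 ≤ K.calib k * S.R := by
  have h1 := S.l2norm_mulVec_le w k i (v := S.dev w k i) fun l hl => S.dev_eq_zero w hl
  have h2 := S.l2norm_dev_le w k i
  have hr := S.r_le_R k i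
  rw [ScoreBound, scoreProxy] at h
  rw [r] at hr
  have hn : (0 : ℝ) < S.n k := Nat.cast_pos.2 (S.n_pos k)
  have hc1 := K.c₁_pos k
  have hc2 := K.c₂_pos k
  have hD := l2norm_nonneg (S.dev w k i)
  set D := l2norm (S.dev w k i)
  set s := l2norm (S.score w k i)
  set t := S.ridgeParam k i * l2norm (fun l => S.coef k l i) with ht
  rw [div_le_iff₀ hn, ← mul_pow, ← ht] at hr
  have h3 : (K.c₂ k ^ 2 * S.n k * D) ^ 2 ≤ 2 * (s ^ 2 + t ^ 2) :=
    (pow_le_pow_left₀ (by positivity) h2 2).trans (by nlinarith [sq_nonneg (s - t)])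
  calc _ ≤ (K.c₁ k * √(S.n k : ℝ) * D) ^ 2 := pow_le_pow_left₀ (l2norm_nonneg _) h1 2
    _ = K.c₁ k ^ 2 / (K.c₂ k ^ 4 * S.n k) * (K.c₂ k ^ 2 * S.n k * D) ^ 2 := by
        rw [mul_pow, mul_pow, Real.sq_sqrt hn.le]
        field_simp
    _ ≤ K.c₁ k ^ 2 / (K.c₂ k ^ 4 * S.n k) *
        (2 * (8 * ((K.σmax / K.c) ^ 2 * (K.c₁ k ^ 2 * S.n k)) * S.R + S.R * S.n k)) := by
        refine mul_le_mul_of_nonneg_left ?_ (by positivity)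
        linarith
    _ = K.calib k * S.R := by
        rw [ModelConstants.calib]
        field_simp

end Setting

/-! ### Measurable dependence of the projection on the design. -/

section Measurability

variable {α : Type*} [MeasurableSpace α] {m ι : Type*} [Fintype m] [DecidableEq m]

lemma measurable_det {A : α → Matrix m m ℝ} (hA : ∀ r s, Measurable fun a => A a r s) :
    Measurable fun a => (A a).det := by
  simp only [Matrix.det_apply]
  exact Finset.measurable_fun_sum _ fun σ _ =>
    (Finset.measurable_fun_prod _ fun r _ => hA _ _).const_smul _

/-- By Cramer's rule the entries are quotients of polynomials in the entries of `A`. The convention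
`0⁻¹ = 0` makes them measurable at singular matrices too. -/
lemma measurable_inv_apply {A : α → Matrix m m ℝ} (hA : ∀ r s, Measurable fun a => A a r s)
    (r s : m) : Measurable fun a => (A a)⁻¹ r s := by
  simp only [Matrix.inv_def, Matrix.smul_apply, Ring.inverse_eq_inv', Matrix.adjugate_apply,
    smul_eq_mul]
  refine (measurable_det hA).inv.mul (measurable_det fun r' s' => ?_)
  by_cases h : r' = s
  · subst h
    simp
  · simpa [Matrix.updateRow_ne h] using hA r' s'

lemma measurable_projOff_apply [DecidableEq ι] {X : α → Matrix m ι ℝ}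
    (hX : ∀ r l, Measurable fun a => X a r l) (A : Finset ι) (r s : m) :
    Measurable fun a => projOff (X a) A r s := by
  simp only [projOff, Matrix.sub_apply, Matrix.mul_apply, Matrix.transpose_apply, colsOn,
    Matrix.submatrix_apply, id]
  refine measurable_const.sub (Finset.measurable_fun_sum _ fun l _ =>
    (Finset.measurable_fun_sum _ fun l' _ => (hX _ _).mul
      (measurable_inv_apply (fun a b => ?_) _ _)).mul (hX _ _))
  simp only [Matrix.mul_apply, Matrix.transpose_apply, Matrix.submatrix_apply, id]
  exact Finset.measurable_fun_sum _ fun c _ => (hX _ _).mul (hX _ _)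

end Measurability

/-! ### Tail bounds for the scores and the projected correlations. -/

namespace Setting

variable {Ω : Type*} [MeasurableSpace Ω] {P : Measure Ω} {K : ModelConstants} (S : Setting P K)

lemma noise_apply (w : Ω) (k : Fin 2) (r : Fin (S.n k)) (i : Fin S.p) :
    S.noise w k r i = ∑ j, S.E w k r j * (1 - S.Γ k)⁻¹ j i := rfl

/-- Linear combinations of the reduced-form errors with fixed coefficients are sub-Gaussian. -/
lemma hasSubgaussianMGF_noise (k : Fin 2) (i : Fin S.p) (u : Fin (S.n k) → ℝ) :
    HasSubgaussianMGF (fun w => ∑ r, u r * S.noise w k r i)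
      ((K.σmax / K.c) ^ 2 * l2norm u ^ 2).toNNReal P := by
  set g : Fin S.p → ℝ := fun j => (1 - S.Γ k)⁻¹ j i with hg
  have hinj : Function.Injective
      (fun e : Fin (S.n k) × Fin S.p => (⟨k, e⟩ : (k : Fin 2) × (Fin (S.n k) × Fin S.p))) :=
    fun a b h => by simpa using h
  have hind := (S.indep_E.precomp hinj).comp (fun e t => u e.1 * g e.2 * t)
    (fun e => measurable_const_mul _)
  have hsum := HasSubgaussianMGF.sum_of_iIndepFun hind (s := Finset.univ) fun e _ =>
    (hasSubgaussianMGF_of_hasLaw_gaussianReal (S.law_E k e.1 e.2)).const_mul (u e.1 * g e.2)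
  refine (hasSubgaussianMGF_mono hsum ?_).congr (ae_of_all _ fun w => ?_)
  · rw [← NNReal.coe_le_coe, Real.coe_toNNReal _ (by positivity)]
    push_cast
    have hgn := S.l2norm_inv_col_le k i
    rw [← hg] at hgn
    have hgn2 : ∑ j, g j ^ 2 ≤ (1 / K.c) ^ 2 := by
      rw [← l2norm_sq]; exact pow_le_pow_left₀ (l2norm_nonneg _) hgn 2
    -- The coefficient of the error `E r j` is a product `u r * g j`, so the sum of the variance
    -- proxies factors, and `‖g‖ ≤ 1 / c`.
    calc _ ≤ ∑ e : Fin (S.n k) × Fin S.p, K.σmax ^ 2 * (u e.1 ^ 2 * g e.2 ^ 2) := by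
          refine Finset.sum_le_sum fun e _ => ?_
          rw [mul_comm (K.σmax ^ 2), ← mul_pow (u e.1)]
          have := pow_le_pow_left₀ (NNReal.coe_nonneg _) (S.σ_le k e.2) 2
          exact mul_le_mul_of_nonneg_left this (sq_nonneg _)
      _ = K.σmax ^ 2 * ((∑ r, u r ^ 2) * ∑ j, g j ^ 2) := by
          rw [← Finset.mul_sum, Finset.sum_mul_sum, Fintype.sum_prod_type]
      _ ≤ K.σmax ^ 2 * ((∑ r, u r ^ 2) * (1 / K.c) ^ 2) := by gcongr
      _ = _ := by rw [l2norm_sq]; ring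
  · simp only [noise_apply, Function.comp, Finset.mul_sum, Fintype.sum_prod_type]
    exact Finset.sum_congr rfl fun r _ => Finset.sum_congr rfl fun j _ => by simp only [hg]; ring

lemma aemeasurable_E (k : Fin 2) (r : Fin (S.n k)) (j : Fin S.p) :
    AEMeasurable (fun w => S.E w k r j) P := (S.law_E k r j).aemeasurable

/-- With `X` frozen, `⟨y, X_Mᵀ ε⟩ = ⟨X_M y, ε⟩` is sub-Gaussian with proxy `scoreProxy * ‖y‖²` by
the upper design bound, so `measure_sum_sq_ge_le` applies in dimension `d`. -/
lemma measure_not_scoreBound_le [IsProbabilityMeasure P] (k : Fin 2) (i : Fin S.p) :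
    P {w | ¬ S.ScoreBound w k i} ≤ ENNReal.ofReal (Real.exp (-S.f k)) := by
  set B : Set ((∀ k, Fin (S.n k) → Fin S.q → ℝ) × (∀ k, Fin (S.n k) → Fin S.p → ℝ)) :=
    {z | 4 * S.scoreProxy k * (S.f k + S.d) ≤
      ∑ l : S.M k i, (∑ r, z.1 k r l * ∑ j, z.2 k r j * (1 - S.Γ k)⁻¹ j i) ^ 2} with hBdef
  have hB : MeasurableSet B := by
    refine measurableSet_le measurable_const ?_
    fun_prop
  have hsub : {w | ¬ S.ScoreBound w k i} ⊆
      {w | ((fun k r l => S.X w k r l : ∀ k, Fin (S.n k) → Fin S.q → ℝ),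
        (fun k r i => S.E w k r i : ∀ k, Fin (S.n k) → Fin S.p → ℝ)) ∈ B} := by
    intro w hw
    simp only [Set.mem_ofPred_eq, ScoreBound, not_le, l2norm_sq] at hw
    -- The `8` in `ScoreBound` comes from `4 (f + d) ≤ 8 R`.
    refine le_trans ?_ hw.le
    have h1 := S.d_le_R
    have h2 := S.f_le_R k
    have h3 := S.scoreProxy_pos k
    nlinarith
  refine (measure_mono hsub).trans (measure_le_of_indepFun ?_ ?_ S.indep_XE hB fun w' => ?_)
  · exact measurable_pi_lambda _ fun k => measurable_pi_lambda _ fun r =>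
      measurable_pi_lambda _ fun l => S.measurable_X k r l
  · exact aemeasurable_pi_lambda _ fun k => aemeasurable_pi_lambda _ fun r =>
      aemeasurable_pi_lambda _ fun j => S.aemeasurable_E k r j
  · have h := measure_sum_sq_ge_le (P := P) (ι := S.M k i)
      (v := fun w l => ∑ r, S.X w' k r l * ∑ j, S.E w k r j * (1 - S.Γ k)⁻¹ j i)
      (aemeasurable_pi_lambda _ fun l => Finset.aemeasurable_fun_sum _ fun r _ =>
        (Finset.aemeasurable_fun_sum _ fun j _ =>
          (S.aemeasurable_E k r j).mul_const _).const_mul _)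
      (S.scoreProxy_pos k) (fun y => ?_) (S.f k)
    · rw [Fintype.card_coe, S.card_M] at h
      exact h
    · have h1 := S.hasSubgaussianMGF_noise k i ((S.X w' k).mulVec (extendZero (S.M k i) y))
      have h2 := S.l2norm_mulVec_le w' k i (v := extendZero (S.M k i) y) fun l hl =>
        extendZero_of_notMem y hl
      rw [l2norm_extendZero] at h2
      refine (hasSubgaussianMGF_mono h1 ?_).congr (ae_of_all _ fun w => ?_)
      · apply Real.toNNReal_le_toNNReal
        rw [← l2norm_sq, scoreProxy, mul_assoc]
        refine mul_le_mul_of_nonneg_left ?_ (sq_nonneg _)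
        refine (pow_le_pow_left₀ (l2norm_nonneg _) h2 2).trans_eq ?_
        rw [mul_pow, mul_pow, Real.sq_sqrt (Nat.cast_nonneg _)]
      · rw [mulVec_extendZero]
        change ∑ r, (∑ l : S.M k i, S.X w' k r l * y l) * S.noise w k r i =
          ∑ l : S.M k i, y l * ∑ r, S.X w' k r l * S.noise w k r i
        simp_rw [Finset.sum_mul, Finset.mul_sum]
        rw [Finset.sum_comm]
        exact Finset.sum_congr rfl fun l _ => Finset.sum_congr rfl fun r _ => by ring

/-- The projected correlation of the `l`-th exogenous variable with the errors of node `i`. -/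
noncomputable def projCorr (w : Ω) (k : Fin 2) (i : Fin S.p) (l : Fin S.q) : ℝ :=
  (fun r => S.X w k r l) ⬝ᵥ (S.proj w k i).mulVec (fun r => S.noise w k r i)

/-- With `X` frozen this is a linear combination of the errors with coefficient vector `H x_l`. Its
norm is at most `‖x_l‖ = √n` because the columns are standardized. -/
lemma measure_projCorr_ge_le [IsProbabilityMeasure P] (k : Fin 2) (i : Fin S.p) (l : Fin S.q)
    {t : ℝ} (ht : 0 ≤ t) :
    P {w | √(S.n k : ℝ) * t ≤ |S.projCorr w k i l|} ≤
      2 * ENNReal.ofReal (Real.exp (-(K.c ^ 2 / (2 * K.σmax ^ 2)) * t ^ 2)) := by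
  set B : Set ((∀ k, Fin (S.n k) → Fin S.q → ℝ) × (∀ k, Fin (S.n k) → Fin S.p → ℝ)) :=
    {z | √(S.n k : ℝ) * t ≤ |∑ r, (∑ s, projOff (Matrix.of (z.1 k)) (anchors (S.Φ k) i) r s *
      z.1 k s l) * ∑ j, z.2 k r j * (1 - S.Γ k)⁻¹ j i|} with hBdef
  have hB : MeasurableSet B := by
    refine measurableSet_le measurable_const ?_
    have h1 : ∀ r s, Measurable fun z : (∀ k, Fin (S.n k) → Fin S.q → ℝ) ×
        (∀ k, Fin (S.n k) → Fin S.p → ℝ) =>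
          projOff (Matrix.of (z.1 k)) (anchors (S.Φ k) i) r s :=
      measurable_projOff_apply (fun r l => by simp only [Matrix.of_apply]; fun_prop) _
    refine Measurable.abs (Finset.measurable_fun_sum _ fun r _ =>
      (Finset.measurable_fun_sum _ fun s _ => (h1 r s).mul (by fun_prop)).mul (by fun_prop))
  have hcorr : ∀ w' w, (fun r => S.X w' k r l) ⬝ᵥ
      (S.proj w' k i).mulVec (fun r => S.noise w k r i) =
      ∑ r, ((S.proj w' k i).mulVec fun s => S.X w' k s l) r * S.noise w k r i := by
    intro w' w
    rw [Matrix.dotProduct_mulVec, ← Matrix.mulVec_transpose, proj_transpose]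
    rfl
  have heq : {w | √(S.n k : ℝ) * t ≤ |S.projCorr w k i l|} =
      {w | ((fun k r l => S.X w k r l : ∀ k, Fin (S.n k) → Fin S.q → ℝ),
        (fun k r i => S.E w k r i : ∀ k, Fin (S.n k) → Fin S.p → ℝ)) ∈ B} := by
    ext w
    simp only [Set.mem_ofPred_eq, projCorr, hcorr w w]
    rfl
  rw [heq]
  refine measure_le_of_indepFun ?_ ?_ S.indep_XE hB fun w' => ?_
  · exact measurable_pi_lambda _ fun k => measurable_pi_lambda _ fun r =>
      measurable_pi_lambda _ fun l => S.measurable_X k r l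
  · exact aemeasurable_pi_lambda _ fun k => aemeasurable_pi_lambda _ fun r =>
      aemeasurable_pi_lambda _ fun j => S.aemeasurable_E k r j
  · have h1 := S.hasSubgaussianMGF_noise k i ((S.proj w' k i).mulVec fun s => S.X w' k s l)
    have h2 : l2norm ((S.proj w' k i).mulVec fun s => S.X w' k s l) ≤ √(S.n k : ℝ) :=
      (S.l2norm_proj_le w' k i _).trans_eq (S.standardized w' k l)
    have h3 : l2norm ((S.proj w' k i).mulVec fun s => S.X w' k s l) ^ 2 ≤ S.n k := by
      refine (pow_le_pow_left₀ (l2norm_nonneg _) h2 2).trans_eq (Real.sq_sqrt (Nat.cast_nonneg _))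
    have h4 := measure_abs_ge_le_of_hasSubgaussianMGF (hasSubgaussianMGF_mono h1
      (Real.toNNReal_le_toNNReal (mul_le_mul_of_nonneg_left h3 (sq_nonneg _))))
      (mul_nonneg (Real.sqrt_nonneg (S.n k : ℝ)) ht)
    refine le_trans (le_of_eq rfl) (h4.trans_eq ?_)
    congr 3
    have := K.σmax_pos
    have := K.c_pos
    have : (0 : ℝ) < S.n k := Nat.cast_pos.2 (S.n_pos k)
    rw [Real.coe_toNNReal _ (by positivity), mul_pow, Real.sq_sqrt (by positivity)]
    field_simp

end Setting

/-! ### The block structure of the stacked networks. -/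

section Blocks

/-- The sign with which the differential effects enter network `k`. -/
noncomputable def netSign (k : Fin 2) : ℝ := if k = 0 then 1 else -1

lemma abs_netSign (k : Fin 2) : |netSign k| = 1 := by
  rw [netSign]; split_ifs <;> simp

lemma reparam_mulVec {ρ : Fin 2 → Type*} {κ : Type*} [Fintype κ] (A : ∀ k, Matrix (ρ k) κ ℝ)
    (b : κ ⊕ κ → ℝ) (k : Fin 2) (r : ρ k) :
    (reparam A).mulVec b ⟨k, r⟩ =
      (A k).mulVec (fun j => b (Sum.inl j) + netSign k * b (Sum.inr j)) r := by
  simp only [Matrix.mulVec, dotProduct, Fintype.sum_sum_type, reparam, Matrix.of_apply,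
    Sum.elim_inl, Sum.elim_inr]
  rw [← Finset.sum_add_distrib]
  refine Finset.sum_congr rfl fun j _ => ?_
  rw [netSign]
  ring

/-- The sign is chosen before the matrix, so the same sign serves an estimate and its target, and
their difference reduces to one block. -/
lemma exists_reparam_apply_eq {κ : Type*} (c : κ ⊕ κ) (k : Fin 2) :
    ∃ s : ℝ, |s| = 1 ∧ ∀ (ρ : Fin 2 → Type) (A : ∀ k, Matrix (ρ k) κ ℝ) (r : ρ k),
      reparam A ⟨k, r⟩ c = s * A k r (Sum.elim id id c) := by
  rcases c with j | j
  · exact ⟨1, by simp, fun ρ A r => by simp [reparam]⟩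
  · exact ⟨netSign k, abs_netSign k, fun ρ A r => by simp [reparam, netSign]⟩

lemma blockDiagonal'_mulVec_apply {m ι : Fin 2 → Type*} [∀ k, Fintype (ι k)]
    (A : ∀ k, Matrix (m k) (ι k) ℝ) (v : (k : Fin 2) × ι k → ℝ) (k : Fin 2) (r : m k) :
    (Matrix.blockDiagonal' A).mulVec v ⟨k, r⟩ = (A k).mulVec (fun l => v ⟨k, l⟩) r := by
  simp only [Matrix.mulVec, dotProduct, Fintype.sum_sigma]
  rw [Finset.sum_eq_single k]
  · simp [Matrix.blockDiagonal'_apply_eq]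
  · intro k' _ hk
    exact Finset.sum_eq_zero fun l _ => by
      rw [Matrix.blockDiagonal'_apply_ne _ _ _ hk.symm, zero_mul]
  · simp

lemma sum_subtype_ne {p : ℕ} (i : Fin p) {g : Fin p → ℝ} (hg : g i = 0) :
    ∑ j : {j : Fin p // j ≠ i}, g j = ∑ j, g j := by
  rw [← Finset.sum_subtype (Finset.univ.erase i) (by simp) g, Finset.sum_erase _ hg]

end Blocks

/-! ### A union bound for three exceptional events. -/

section Probability

/-- Only monotonicity and subadditivity are used, so `G` need not be measurable. In the theorem `G`
quantifies over all minimizers and involves arbitrary data-dependent weights. -/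
lemma ofReal_one_sub_le {Ω : Type*} [MeasurableSpace Ω] {P : Measure Ω} [IsProbabilityMeasure P]
    {G A B C : Set Ω} {a b c : ℝ} (ha : 0 ≤ a) (hb : 0 ≤ b) (hc : 0 ≤ c)
    (hA : P A ≤ ENNReal.ofReal a) (hB : P B ≤ ENNReal.ofReal b) (hC : P C ≤ ENNReal.ofReal c)
    (hcover : ∀ w, w ∉ A → w ∉ B → w ∉ C → w ∈ G) :
    ENNReal.ofReal (1 - a - b - c) ≤ P G := by
  rw [ENNReal.ofReal_sub _ hc, ENNReal.ofReal_sub _ hb, ENNReal.ofReal_sub _ ha,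
    ENNReal.ofReal_one, tsub_le_iff_right, tsub_le_iff_right, tsub_le_iff_right]
  have huniv : (Set.univ : Set Ω) ⊆ ((G ∪ C) ∪ B) ∪ A := by
    intro w _
    by_contra h
    simp only [Set.mem_union, not_or] at h
    exact h.1.1.1 (hcover w h.2 h.1.2 h.1.1.2)
  calc (1 : ℝ≥0∞) = P Set.univ := measure_univ.symm
    _ ≤ P (((G ∪ C) ∪ B) ∪ A) := measure_mono huniv
    _ ≤ P G + P C + P B + P A := (measure_union_le _ _).trans <|
        add_le_add_left ((measure_union_le _ _).trans <|
          add_le_add_left (measure_union_le _ _) _) _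
    _ ≤ _ := by gcongr

end Probability

/-- The constant of the calibration bound. -/
noncomputable def ModelConstants.calibTot (K : ModelConstants) : ℝ := K.calib 0 + K.calib 1

lemma ModelConstants.calibTot_pos (K : ModelConstants) : 0 < K.calibTot :=
  add_pos (K.calib_pos 0) (K.calib_pos 1)

lemma ModelConstants.calib_le (K : ModelConstants) (k : Fin 2) : K.calib k ≤ K.calibTot := by
  have h0 := K.calib_pos 0
  have h1 := K.calib_pos 1
  rw [calibTot]
  fin_cases k
  · change K.calib 0 ≤ _; linarith
  · change K.calib 1 ≤ _; linarith

lemma ModelConstants.c₁_le_cmax (K : ModelConstants) (k : Fin 2) : K.c₁ k ≤ K.cmax := by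
  fin_cases k
  · exact le_max_left _ _
  · exact le_max_right _ _

lemma ModelConstants.cmax_pos (K : ModelConstants) : 0 < K.cmax :=
  (K.c₁_pos 0).trans_le (K.c₁_le_cmax 0)

/-! ### The calibration bound and the residual of the construction stage. -/

namespace Setting

variable {Ω : Type*} [MeasurableSpace Ω] {P : Measure Ω} {K : ModelConstants} (S : Setting P K)

lemma l2norm_XX_mulVec_sq_le {w : Ω} (j : Fin S.p ⊕ Fin S.p)
    (h : ∀ k, S.ScoreBound w k (Sum.elim id id j)) :
    l2norm ((S.XX w).mulVec fun l => S.PiHat w l j - S.Pi l j) ^ 2 ≤ K.calibTot * S.R := by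
  have hk : ∀ k, l2norm (fun r => (S.XX w).mulVec (fun l => S.PiHat w l j - S.Pi l j) ⟨k, r⟩) ^ 2 ≤
      K.calib k * S.R := by
    intro k
    obtain ⟨s, hs, hcol⟩ := exists_reparam_apply_eq j k
    have : (fun r => (S.XX w).mulVec (fun l => S.PiHat w l j - S.Pi l j) ⟨k, r⟩) =
        s • (S.X w k).mulVec (S.dev w k (Sum.elim id id j)) := by
      ext r
      rw [XX, blockDiagonal'_mulVec_apply, ← Matrix.mulVec_smul]
      congr 1
      ext l
      simp only [PiHat, Pi, hcol, Pi.smul_apply, dev, smul_eq_mul]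
      ring
    rw [this, l2norm_smul, hs, one_mul]
    exact S.l2norm_mulVec_dev_sq_le (h k)
  rw [l2norm_sq_sigma, Fin.sum_univ_two, ModelConstants.calibTot, add_mul]
  exact add_le_add (hk 0) (hk 1)

theorem calibrationBound [IsProbabilityMeasure P] : S.CalibrationBound K.calibTot := by
  intro j
  have := ofReal_one_sub_le (P := P) (C := ∅) (Real.exp_pos _).le (Real.exp_pos _).le le_rfl
    (S.measure_not_scoreBound_le 0 (Sum.elim id id j))
    (S.measure_not_scoreBound_le 1 (Sum.elim id id j)) (c := 0) (by simp)
    (G := {w | l2norm ((S.XX w).mulVec fun l => S.PiHat w l j - S.Pi l j) ^ 2 ≤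
      K.calibTot * S.R})
    fun w h0 h1 _ => S.l2norm_XX_mulVec_sq_le j fun k => by
      fin_cases k
      · exact not_not.1 h0
      · exact not_not.1 h1
  rwa [sub_zero] at this

lemma H_mulVec_apply (w : Ω) (i : Fin S.p) (v : (k : Fin 2) × Fin (S.n k) → ℝ) (k : Fin 2)
    (r : Fin (S.n k)) :
    (S.H w i).mulVec v ⟨k, r⟩ = (S.proj w k i).mulVec (fun r => v ⟨k, r⟩) r :=
  blockDiagonal'_mulVec_apply (m := fun k => Fin (S.n k)) (fun k => S.proj w k i) v k r

lemma H_transpose (w : Ω) (i : Fin S.p) : (S.H w i).transpose = S.H w i := by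
  rw [H, Matrix.blockDiagonal'_transpose]
  congr 1
  ext1 k
  exact S.proj_transpose w k i

lemma l2norm_H_mulVec_le (w : Ω) (i : Fin S.p) (v : (k : Fin 2) × Fin (S.n k) → ℝ) :
    l2norm ((S.H w i).mulVec v) ≤ l2norm v := by
  refine l2norm_le_of_sq_le (l2norm_nonneg _) ?_
  rw [l2norm_sq_sigma, l2norm_sq_sigma v]
  refine Finset.sum_le_sum fun k _ => ?_
  simp_rw [H_mulVec_apply]
  exact pow_le_pow_left₀ (l2norm_nonneg _) (S.l2norm_proj_le w k i _) 2

lemma effects_net (i : Fin S.p) (k : Fin 2) :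
    (fun j => S.beta i (Sum.inl j) + netSign k * S.beta i (Sum.inr j)) =
      fun j : {j : Fin S.p // j ≠ i} => S.Γ k j i := by
  ext j
  fin_cases k
  · simp only [beta, effects, Sum.elim_inl, Sum.elim_inr, netSign, Fin.zero_eta, if_true]; ring
  · simp only [beta, effects, Sum.elim_inl, Sum.elim_inr, netSign, Fin.mk_one, one_ne_zero,
      if_false]; ring

/-- The combination of the calibration errors of the nodes other than `i` with the effects of these
nodes on node `i`. -/
noncomputable def devEffect (w : Ω) (k : Fin 2) (i : Fin S.p) : Fin S.q → ℝ :=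
  (dropCol i (Matrix.of fun l j => S.dev w k j l)).mulVec fun j => S.Γ k j i

/-- In network `k` the fit at `β_i` is `X` times the estimated columns weighted by `Γ k · i`. By
`coef_eq`, subtracting it from `Y_i` leaves `X Φ_i + ε_i` minus the weighted calibration errors;
`Φ_i` is supported on the anchors, so the projection kills `X Φ_i`. -/
lemma residual_apply (w : Ω) (i : Fin S.p) (k : Fin 2) (r : Fin (S.n k)) :
    ((S.H w i).mulVec (S.Yi w i) - (S.H w i).mulVec ((S.ZHatDrop w i).mulVec (S.beta i))) ⟨k, r⟩ =
      (S.proj w k i).mulVec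
        ((fun r => S.noise w k r i) - (S.X w k).mulVec (S.devEffect w k i)) r := by
  rw [← Matrix.mulVec_sub, H_mulVec_apply]
  have h1 : (fun r => (S.Yi w i - (S.ZHatDrop w i).mulVec (S.beta i)) ⟨k, r⟩) =
      (S.X w k).mulVec (fun l => S.Φ k l i) +
        ((fun r => S.noise w k r i) - (S.X w k).mulVec (S.devEffect w k i)) := by
    have hZ : (fun r => (S.ZHatDrop w i).mulVec (S.beta i) ⟨k, r⟩) =
        (S.X w k).mulVec ((dropCol i (S.coefHat w k)).mulVec fun j => S.Γ k j i) := by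
      ext r
      rw [ZHatDrop, reparam_mulVec, effects_net, Matrix.mulVec_mulVec]
      rfl
    have hY : (fun r => S.Yi w i ⟨k, r⟩) =
        (S.X w k).mulVec (fun l => S.coef k l i) + fun r => S.noise w k r i :=
      S.reduced_form_col w k i
    have hc : (fun l => S.coef k l i) = (fun l => S.Φ k l i) +
        ((dropCol i (S.coefHat w k)).mulVec fun j => S.Γ k j i) - S.devEffect w k i := by
      ext l
      have h2 := congrFun (congrFun (S.coef_eq k) l) i
      rw [Matrix.add_apply, Matrix.mul_apply,
        ← sum_subtype_ne i (by rw [S.Γ_diag, mul_zero])] at h2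
      rw [h2]
      simp only [Pi.add_apply, Pi.sub_apply, devEffect, Matrix.mulVec, dotProduct, dropCol,
        Matrix.submatrix_apply, id, Matrix.of_apply, dev]
      rw [add_sub_assoc, ← Finset.sum_sub_distrib]
      congr 1
      exact Finset.sum_congr rfl fun j _ => by ring
    have h3 : (fun r => (S.Yi w i - (S.ZHatDrop w i).mulVec (S.beta i)) ⟨k, r⟩) =
        (fun r => S.Yi w i ⟨k, r⟩) - fun r => (S.ZHatDrop w i).mulVec (S.beta i) ⟨k, r⟩ := rfl
    rw [h3, hZ, hY, hc, Matrix.mulVec_sub, Matrix.mulVec_add]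
    abel
  rw [h1, Matrix.mulVec_add, proj, projOff_mulVec_of_support (S.isUnit_det_gram_anchors w k i)
    (fun l hl => by simpa [anchors, supp] using hl), zero_add]

/-- In each network a calibrated regressor is, up to sign, `X` times an estimated column; the `2`
counts the networks. As the projection is symmetric and idempotent, it needs to act only once. -/
lemma abs_transpose_mulVec_residual_le (w : Ω) (i : Fin S.p)
    (c : {j : Fin S.p // j ≠ i} ⊕ {j : Fin S.p // j ≠ i}) {b : ℝ}
    (h : ∀ k j, |(S.X w k).mulVec (fun l => S.coefHat w k l j) ⬝ᵥ (S.proj w k i).mulVec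
        ((fun r => S.noise w k r i) - (S.X w k).mulVec (S.devEffect w k i))| ≤ b) :
    |(S.H w i * S.ZHatDrop w i).transpose.mulVec ((S.H w i).mulVec (S.Yi w i) -
      (S.H w i * S.ZHatDrop w i).mulVec (S.beta i)) c| ≤ 2 * b := by
  rw [Matrix.transpose_mul, ← Matrix.mulVec_mulVec, ← Matrix.mulVec_mulVec, H_transpose]
  set η := (S.H w i).mulVec (S.Yi w i) -
    (S.H w i).mulVec ((S.ZHatDrop w i).mulVec (S.beta i)) with hη
  have h1 : (S.ZHatDrop w i).transpose.mulVec ((S.H w i).mulVec η) c =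
      ∑ k, ∑ r, S.ZHatDrop w i ⟨k, r⟩ c * (S.H w i).mulVec η ⟨k, r⟩ := by
    simp only [Matrix.mulVec, dotProduct, Matrix.transpose_apply, Fintype.sum_sigma]
  have h2 : ∀ k, |∑ r, S.ZHatDrop w i ⟨k, r⟩ c * (S.H w i).mulVec η ⟨k, r⟩| ≤ b := by
    intro k
    obtain ⟨s, hs, hcol⟩ := exists_reparam_apply_eq c k
    have h3 : ∀ r, (S.H w i).mulVec η ⟨k, r⟩ = (S.proj w k i).mulVec
        ((fun r => S.noise w k r i) - (S.X w k).mulVec (S.devEffect w k i)) r := by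
      intro r
      rw [H_mulVec_apply]
      simp_rw [hη, residual_apply]
      rw [show (fun r => (S.proj w k i).mulVec ((fun r => S.noise w k r i) -
        (S.X w k).mulVec (S.devEffect w k i)) r) = (S.proj w k i).mulVec
        ((fun r => S.noise w k r i) - (S.X w k).mulVec (S.devEffect w k i)) from rfl,
        Matrix.mulVec_mulVec, proj_mul_self]
    have h4 : ∑ r, S.ZHatDrop w i ⟨k, r⟩ c * (S.H w i).mulVec η ⟨k, r⟩ =
        s * ((S.X w k).mulVec (fun l => S.coefHat w k l (Sum.elim id id c).1) ⬝ᵥ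
          (S.proj w k i).mulVec
            ((fun r => S.noise w k r i) - (S.X w k).mulVec (S.devEffect w k i))) := by
      rw [dotProduct, Finset.mul_sum]
      refine Finset.sum_congr rfl fun r _ => ?_
      rw [h3, ZHatDrop, hcol, mul_assoc]
      rfl
    rw [h4, abs_mul, hs, one_mul]
    exact h k _
  rw [h1, Fin.sum_univ_two, two_mul]
  exact (abs_add_le _ _).trans (add_le_add (h2 0) (h2 1))

end Setting

/-! ### Correlation of the calibrated regressors with the residual. -/

namespace Setting

variable {Ω : Type*} [MeasurableSpace Ω] {P : Measure Ω} {K : ModelConstants} (S : Setting P K)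

lemma n_cast_pos (k : Fin 2) : (0 : ℝ) < S.n k := Nat.cast_pos.2 (S.n_pos k)

lemma nTot_pos : 0 < S.nTot := add_pos (S.n_cast_pos 0) (S.n_cast_pos 1)

lemma nMin_pos : 0 < S.nMin := lt_min (S.n_cast_pos 0) (S.n_cast_pos 1)

lemma nMin_le_nTot : S.nMin ≤ S.nTot :=
  (min_le_left _ _).trans (le_add_of_nonneg_right (S.n_cast_pos 1).le)

lemma n_le_nTot (k : Fin 2) : (S.n k : ℝ) ≤ S.nTot := by
  have h0 := S.n_cast_pos 0
  have h1 := S.n_cast_pos 1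
  rw [nTot]
  fin_cases k
  · change (S.n 0 : ℝ) ≤ _; linarith
  · change (S.n 1 : ℝ) ≤ _; linarith

lemma l1norm_coef_le (k : Fin 2) (j : Fin S.p) : l1norm (fun l => S.coef k l j) ≤ S.normPi := by
  have h := le_ciSup (f := fun c => ∑ r, |S.Pi r c|) (Set.finite_range _).bddAbove (Sum.inl j)
  refine le_trans ?_ h
  simp only [Fintype.sum_sigma]
  exact Finset.single_le_sum (f := fun k => ∑ l, |S.coef k l j|)
    (fun _ _ => Finset.sum_nonneg fun _ _ => abs_nonneg _) (Finset.mem_univ k)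

lemma normPi_nonneg : 0 ≤ S.normPi :=
  Real.iSup_nonneg fun _ => Finset.sum_nonneg fun _ _ => abs_nonneg _

lemma normB_nonneg : 0 ≤ S.normB := Real.iSup_nonneg fun _ => l1norm_nonneg _

lemma l1norm_beta_le (i : Fin S.p) : l1norm (S.beta i) ≤ S.normB :=
  le_ciSup (f := fun i => l1norm (S.beta i)) (Set.finite_range _).bddAbove i

/-- The effects in either network are the average effects plus or minus the differential ones. -/
lemma l1norm_Γ_le (k : Fin 2) (i : Fin S.p) :
    l1norm (fun j : {j : Fin S.p // j ≠ i} => S.Γ k j i) ≤ l1norm (S.beta i) := by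
  rw [l1norm, l1norm, Fintype.sum_sum_type, ← Finset.sum_add_distrib]
  refine Finset.sum_le_sum fun j _ => ?_
  rw [← congrFun (S.effects_net i k) j]
  refine (abs_add_le _ _).trans_eq ?_
  rw [abs_mul, abs_netSign, one_mul]

lemma beta_eq_zero {i : Fin S.p} {j : {j : Fin S.p // j ≠ i} ⊕ {j : Fin S.p // j ≠ i}}
    (h : j ∉ S.active i) : S.beta i j = 0 := by
  by_contra h0
  exact h (by simpa [active, supp] using h0)

lemma l1norm_beta_eq_zero {i : Fin S.p} (h : ¬ (S.active i).Nonempty) :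
    l1norm (S.beta i) = 0 :=
  Finset.sum_eq_zero fun j _ => by
    rw [S.beta_eq_zero fun hj => h ⟨j, hj⟩, abs_zero]

lemma l2norm_X_coef_le (w : Ω) (k : Fin 2) (j : Fin S.p) :
    l2norm ((S.X w k).mulVec fun l => S.coef k l j) ≤ K.cmax * √S.nTot * S.normPi := by
  refine (S.l2norm_mulVec_le w k j fun l hl => S.coef_eq_zero hl).trans ?_
  have h1 := (l2norm_le_l1norm _).trans (S.l1norm_coef_le k j)
  have h2 := K.c₁_le_cmax k
  have h3 := Real.sqrt_le_sqrt (S.n_le_nTot k)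
  have h4 := K.cmax_pos
  have := l2norm_nonneg fun l => S.coef k l j
  gcongr

lemma l2norm_X_dev_le {w : Ω} {k : Fin 2} {j : Fin S.p} (h : S.ScoreBound w k j) :
    l2norm ((S.X w k).mulVec (S.dev w k j)) ≤ √(K.calibTot * S.R) := by
  apply Real.le_sqrt_of_sq_le
  exact (S.l2norm_mulVec_dev_sq_le h).trans
    (mul_le_mul_of_nonneg_right (K.calib_le k) S.R_nonneg)

/-- The bound keeps `l1norm (S.beta i)` instead of `normB` because it must vanish when the active
set is empty, where no sample size condition is available. -/
lemma l2norm_X_devEffect_le {w : Ω} {k : Fin 2} {i : Fin S.p} (h : ∀ j, S.ScoreBound w k j) :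
    l2norm ((S.X w k).mulVec (S.devEffect w k i)) ≤
      l1norm (S.beta i) * √(K.calibTot * S.R) := by
  rw [devEffect, Matrix.mulVec_mulVec]
  refine (l2norm_mulVec_le_l1norm_mul _ _ (a := √(K.calibTot * S.R)) fun j _ => ?_).trans
    (mul_le_mul_of_nonneg_right (S.l1norm_Γ_le k i) (Real.sqrt_nonneg _))
  exact S.l2norm_X_dev_le (h j)

/-- The error is supported on `d` coordinates, so its `ℓ₁` norm is at most `√d` times its `ℓ₂` norm,
which the lower design bound compares with the prediction error. -/
lemma l1norm_dev_le {w : Ω} {k : Fin 2} {j : Fin S.p} (h : S.ScoreBound w k j) :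
    l1norm (S.dev w k j) * √(S.n k : ℝ) ≤ √(S.d : ℝ) * √(K.calibTot * S.R) / K.c₂ k := by
  have h1 : l1norm (S.dev w k j) ≤ √(S.d : ℝ) * l2norm (S.dev w k j) := by
    have h2 := sum_abs_le_sqrt_card_mul_l2norm (S.M k j) (S.dev w k j)
    rw [l2norm_restrict fun l hl => S.dev_eq_zero w hl, S.card_M] at h2
    refine le_trans (le_of_eq ?_) h2
    exact (Finset.sum_subset (Finset.subset_univ _) fun l _ hl => by
      rw [S.dev_eq_zero w hl, abs_zero]).symm
  have h3 := (S.le_l2norm_mulVec w k j fun l hl => S.dev_eq_zero w hl).trans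
    (S.l2norm_X_dev_le h)
  have hc := K.c₂_pos k
  rw [le_div_iff₀ hc]
  calc _ ≤ √(S.d : ℝ) * l2norm (S.dev w k j) * √(S.n k : ℝ) * K.c₂ k := by gcongr
    _ = √(S.d : ℝ) * (K.c₂ k * √(S.n k : ℝ) * l2norm (S.dev w k j)) := by ring
    _ ≤ _ := by gcongr

lemma X_mulVec_dotProduct_proj_noise (w : Ω) (k : Fin 2) (i : Fin S.p) (v : Fin S.q → ℝ) :
    (S.X w k).mulVec v ⬝ᵥ (S.proj w k i).mulVec (fun r => S.noise w k r i) =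
      v ⬝ᵥ fun l => S.projCorr w k i l := by
  rw [dotProduct_comm, Matrix.dotProduct_mulVec, dotProduct_comm]
  congr 1
  ext l
  rw [projCorr, dotProduct_comm]
  rfl

/-- The bound on the projected correlations, relative to the column norms of the designs. -/
noncomputable def corrLevel : ℝ :=
  S.normB * √(min (S.nTot * S.normPi ^ 2 / S.d) S.R * Real.log S.p)

/-- The estimated column is split into true column and error. Against the noise each part is handled
by its `ℓ₁` norm and the largest correlation; against the calibration errors Cauchy-Schwarz is used,
the projection being a contraction. -/
lemma abs_dotProduct_proj_residual_le {w : Ω} {k : Fin 2} {i : Fin S.p}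
    (hscore : ∀ j, S.ScoreBound w k j)
    (hcorr : ∀ l, |S.projCorr w k i l| ≤ √(S.n k : ℝ) * S.corrLevel) (j : Fin S.p) :
    |(S.X w k).mulVec (fun l => S.coefHat w k l j) ⬝ᵥ (S.proj w k i).mulVec
        ((fun r => S.noise w k r i) - (S.X w k).mulVec (S.devEffect w k i))| ≤
      (S.normPi * √S.nTot + √(S.d : ℝ) * √(K.calibTot * S.R) / K.c₂ k) * S.corrLevel +
      (K.cmax * √S.nTot * S.normPi + √(K.calibTot * S.R)) *
        (l1norm (S.beta i) * √(K.calibTot * S.R)) := by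
  have hsplit : (fun l => S.coefHat w k l j) = (fun l => S.coef k l j) + S.dev w k j := by
    ext l; simp [dev]
  have hlev : 0 ≤ S.corrLevel := mul_nonneg S.normB_nonneg (Real.sqrt_nonneg _)
  have hPi := S.normPi_nonneg
  rw [Matrix.mulVec_sub, dotProduct_sub, X_mulVec_dotProduct_proj_noise]
  refine (abs_sub _ _).trans (add_le_add ?_ ?_)
  · rw [hsplit, add_dotProduct, add_mul]
    refine (abs_add_le _ _).trans (add_le_add ?_ ?_)
    · refine (abs_dotProduct_le_l1norm_mul hcorr).trans ?_
      rw [← mul_assoc]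
      have h1 := S.l1norm_coef_le k j
      have h3 := Real.sqrt_le_sqrt (S.n_le_nTot k)
      gcongr
    · refine (abs_dotProduct_le_l1norm_mul hcorr).trans ?_
      rw [← mul_assoc]
      exact mul_le_mul_of_nonneg_right (S.l1norm_dev_le (hscore j)) hlev
  · refine (abs_dotProduct_le _ _).trans ?_
    refine mul_le_mul ?_ ((S.l2norm_proj_le w k i _).trans (S.l2norm_X_devEffect_le hscore))
      (l2norm_nonneg _) (by have := K.cmax_pos; positivity)
    rw [hsplit, Matrix.mulVec_add]
    exact (l2norm_add_le _ _).trans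
      (add_le_add (S.l2norm_X_coef_le w k j) (S.l2norm_X_dev_le (hscore j)))

lemma corrLevel_sq_ge_h (hp : 1 ≤ S.p) : S.h ≤ S.corrLevel ^ 2 := by
  have hlog : 0 ≤ Real.log S.p := Real.log_nonneg (by exact_mod_cast hp)
  have hn := S.nTot_pos
  have hR := S.R_nonneg
  have hmin : 0 ≤ min (S.nTot * S.normPi ^ 2 / S.d) S.R := le_min (by positivity) hR
  rw [corrLevel, mul_pow, Real.sq_sqrt (mul_nonneg hmin hlog), h, mul_assoc]
  exact mul_le_mul_of_nonneg_right (min_le_left _ _) (mul_nonneg hmin hlog)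

end Setting

/-- The constant in the bound on the correlations of the calibrated regressors with the residuals. -/
noncomputable def ModelConstants.corrConst (K : ModelConstants) : ℝ :=
  1 + √K.calibTot * (1 / K.c₂ 0 + 1 / K.c₂ 1) + 2 * K.cmax * √K.calibTot / √(Real.log 2)

lemma ModelConstants.corrConst_pos (K : ModelConstants) : 0 < K.corrConst := by
  have := K.c₂_pos 0
  have := K.c₂_pos 1
  have := K.cmax_pos
  rw [corrConst]
  positivity

lemma ModelConstants.inv_c₂_le (K : ModelConstants) (k : Fin 2) :
    1 / K.c₂ k ≤ 1 / K.c₂ 0 + 1 / K.c₂ 1 := by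
  have h0 := one_div_pos.2 (K.c₂_pos 0)
  have h1 := one_div_pos.2 (K.c₂_pos 1)
  fin_cases k
  · change 1 / K.c₂ 0 ≤ _; linarith
  · change 1 / K.c₂ 1 ≤ _; linarith

namespace Setting

variable {Ω : Type*} [MeasurableSpace Ω] {P : Measure Ω} {K : ModelConstants} (S : Setting P K)

/-- All terms are compared with `Q = √n ‖B‖₁ ‖Π‖₁ √(R log p)`. -/
lemma four_div_mul_le_rate (hp : 2 ≤ S.p) (hd : 0 < S.d) (k : Fin 2) (i : Fin S.p)
    (hact : (S.active i).Nonempty → K.calibTot * S.R ≤ S.nTot * K.cmax ^ 2 * S.normPi ^ 2) :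
    4 / S.nTot * (2 * ((S.normPi * √S.nTot + √(S.d : ℝ) * √(K.calibTot * S.R) / K.c₂ k) *
        S.corrLevel + (K.cmax * √S.nTot * S.normPi + √(K.calibTot * S.R)) *
        (l1norm (S.beta i) * √(K.calibTot * S.R)))) ≤ 8 * K.corrConst * S.rate := by
  have hlog2 : 0 < Real.log 2 := Real.log_pos (by norm_num)
  have hlogp : Real.log 2 ≤ Real.log S.p := Real.log_le_log (by norm_num) (by exact_mod_cast hp)
  have hlog : 0 ≤ Real.log S.p := hlog2.le.trans hlogp
  have hn := S.nTot_pos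
  have hR := S.R_nonneg
  have hB := S.normB_nonneg
  have hPi := S.normPi_nonneg
  have hC := K.calibTot_pos
  have hcm := K.cmax_pos
  have hc2 := K.c₂_pos k
  have hdpos : (0 : ℝ) < S.d := Nat.cast_pos.2 hd
  set sn := √S.nTot with hsn
  set sR := √S.R with hsR
  set sl := √(Real.log S.p) with hsl
  set sC := √K.calibTot with hsC
  have hsn0 : 0 < sn := Real.sqrt_pos.2 hn
  have hsR0 : 0 ≤ sR := Real.sqrt_nonneg _
  have hsl0 : 0 ≤ sl := Real.sqrt_nonneg _
  have hsC0 : 0 ≤ sC := Real.sqrt_nonneg _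
  have hCR : √(K.calibTot * S.R) = sC * sR := Real.sqrt_mul hC.le _
  set Q := sn * S.normB * S.normPi * (sR * sl) with hQ
  have hQ0 : 0 ≤ Q := by positivity
  have hlev1 : S.corrLevel ≤ S.normB * (sR * sl) := by
    rw [corrLevel, hsR, hsl, ← Real.sqrt_mul hR]
    have := min_le_right (S.nTot * S.normPi ^ 2 / S.d) S.R
    gcongr
  -- Here the other half of the minimum is used: its denominator `d` absorbs the `√d` from the `ℓ₁`
  -- norm of the calibration error.
  have hlev2 : √(S.d : ℝ) * S.corrLevel ≤ S.normB * (sn * S.normPi * sl) := by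
    have h1 : √(S.d : ℝ) * √(min (S.nTot * S.normPi ^ 2 / S.d) S.R * Real.log S.p) ≤
        sn * S.normPi * sl := by
      rw [← Real.sqrt_mul hdpos.le]
      apply Real.sqrt_le_iff.2 ⟨by positivity, ?_⟩
      rw [mul_pow, mul_pow, Real.sq_sqrt hn.le, Real.sq_sqrt hlog, ← mul_assoc]
      refine mul_le_mul_of_nonneg_right ?_ hlog
      have := mul_le_mul_of_nonneg_left (min_le_left (S.nTot * S.normPi ^ 2 / S.d) S.R) hdpos.le
      rwa [mul_div_cancel₀ _ hdpos.ne'] at this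
    calc _ = S.normB * (√(S.d : ℝ) *
          √(min (S.nTot * S.normPi ^ 2 / S.d) S.R * Real.log S.p)) := by rw [corrLevel]; ring
      _ ≤ _ := by gcongr
  have hpart1 : (S.normPi * sn + √(S.d : ℝ) * (sC * sR) / K.c₂ k) * S.corrLevel ≤
      (1 + sC * (1 / K.c₂ 0 + 1 / K.c₂ 1)) * Q := by
    have hinv := K.inv_c₂_le k
    calc _ = S.normPi * sn * S.corrLevel +
          sC * (1 / K.c₂ k) * (sR * (√(S.d : ℝ) * S.corrLevel)) := by ring
      _ ≤ S.normPi * sn * (S.normB * (sR * sl)) +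
          sC * (1 / K.c₂ 0 + 1 / K.c₂ 1) * (sR * (S.normB * (sn * S.normPi * sl))) := by
          have : 0 < 1 / K.c₂ k := by positivity
          have : 0 ≤ 1 / K.c₂ 0 + 1 / K.c₂ 1 := by linarith
          have : 0 ≤ √(S.d : ℝ) * S.corrLevel :=
            mul_nonneg (Real.sqrt_nonneg _) (mul_nonneg hB (Real.sqrt_nonneg _))
          gcongr
      _ = _ := by rw [hQ]; ring
  -- By `hact` one factor `√(C₂ R)` is at most `c_max √n ‖Π‖₁`. The factor `√(log p)` absent on the
  -- left is supplied by `p ≥ 2`, which explains `√(log 2)` in `corrConst`.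
  have hpart2 : (K.cmax * sn * S.normPi + sC * sR) * (l1norm (S.beta i) * (sC * sR)) ≤
      2 * K.cmax * sC / √(Real.log 2) * Q := by
    by_cases hne : (S.active i).Nonempty
    · have h1 : sC * sR ≤ K.cmax * sn * S.normPi := by
        rw [← hCR]
        refine Real.sqrt_le_iff.2 ⟨by positivity, (hact hne).trans_eq ?_⟩
        rw [mul_pow, mul_pow, Real.sq_sqrt hn.le]
        ring
      have h2 := S.l1norm_beta_le i
      have h3 : √(Real.log 2) ≤ sl := Real.sqrt_le_sqrt hlogp
      have h4 : 0 < √(Real.log 2) := Real.sqrt_pos.2 hlog2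
      have h5 : 1 ≤ sl / √(Real.log 2) := (one_le_div h4).2 h3
      calc _ ≤ (K.cmax * sn * S.normPi + K.cmax * sn * S.normPi) *
            (S.normB * (sC * sR)) := by
            have := l1norm_nonneg (S.beta i)
            gcongr
        _ = 2 * K.cmax * sC * (sn * S.normB * S.normPi * sR) * 1 := by ring
        _ ≤ 2 * K.cmax * sC * (sn * S.normB * S.normPi * sR) * (sl / √(Real.log 2)) := by
            gcongr
        _ = _ := by rw [hQ]; ring
    · rw [S.l1norm_beta_eq_zero hne]
      simp only [zero_mul, mul_zero]
      positivity
  have hQn : 1 / S.nTot * Q ≤ S.rate := by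
    have h1 : 1 / S.nTot * Q = S.normB * S.normPi * (sR * sl / sn) := by
      have : S.nTot = sn ^ 2 := (Real.sq_sqrt hn.le).symm
      rw [this, hQ]
      field_simp
    have h2 : sR * sl / sn ≤ √(S.R * Real.log S.p / S.nMin) := by
      rw [hsR, hsl, hsn, ← Real.sqrt_mul hR, ← Real.sqrt_div (by positivity)]
      have := S.nMin_le_nTot
      have := S.nMin_pos
      gcongr
    rw [h1, rate]
    gcongr
  rw [hCR]
  calc _ ≤ 4 / S.nTot * (2 * ((1 + sC * (1 / K.c₂ 0 + 1 / K.c₂ 1)) * Q +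
        2 * K.cmax * sC / √(Real.log 2) * Q)) := by gcongr
    _ = 8 * K.corrConst * (1 / S.nTot * Q) := by rw [ModelConstants.corrConst]; ring
    _ ≤ _ := mul_le_mul_of_nonneg_left hQn (by have := K.corrConst_pos; positivity)

end Setting

/-! ### Restricted eigenvalues, weights and scaling of the error bounds. -/

lemma mul_l2norm_le_of_le_restrictedEigenvalue {m ι : Type*} [Fintype m] [Fintype ι]
    [DecidableEq ι] [Nonempty m] {A : Matrix m ι ℝ} {S : Finset ι} {φ : ℝ}
    (h : (φ : EReal) ≤ restrictedEigenvalue A S) {δ : ι → ℝ}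
    (hδ : ∑ j ∈ Sᶜ, |δ j| ≤ 3 * ∑ j ∈ S, |δ j|) :
    φ * (√(Fintype.card m : ℝ) * l2norm fun j : S => δ j) ≤ l2norm (A.mulVec δ) := by
  by_cases hne : ∃ j ∈ S, δ j ≠ 0
  · have h1 : (φ : EReal) ≤ ((l2norm (A.mulVec δ) /
        (√(Fintype.card m : ℝ) * l2norm (fun j : S => δ j)) : ℝ) : EReal) :=
      h.trans ((iInf_le _ δ).trans ((iInf_le _ hδ).trans (iInf_le _ hne)))
    rw [EReal.coe_le_coe_iff, le_div_iff₀] at h1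
    · exact h1
    · obtain ⟨j, hj, hj0⟩ := hne
      refine mul_pos (Real.sqrt_pos.2 (Nat.cast_pos.2 Fintype.card_pos))
        ((l2norm_nonneg _).lt_of_ne fun h0 => hj0 ?_)
      exact congrFun (eq_zero_of_l2norm_eq_zero h0.symm) ⟨j, hj⟩
  · push Not at hne
    have : (fun j : S => δ j) = 0 := funext fun j => hne j j.2
    rw [this, l2norm_zero, mul_zero, mul_zero]
    exact l2norm_nonneg _

lemma minAbs_pos {ι : Type*} [Finite ι] [Nonempty ι] {v : ι → ℝ} (h : ∀ j, 0 < v j) :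
    0 < minAbs v := by
  obtain ⟨j, hj⟩ := exists_eq_ciInf_of_finite (f := fun j => |v j|)
  rw [minAbs, ← hj]
  exact abs_pos.2 (h j).ne'

lemma minAbs_le {ι : Type*} [Finite ι] {v : ι → ℝ} (h : ∀ j, 0 < v j) (j : ι) :
    minAbs v ≤ v j :=
  (ciInf_le (Set.finite_range fun j => |v j|).bddBelow j).trans_eq (abs_of_pos (h j))

/-- The choice `C₄ = 3 T` fits both bounds: `24 T = 8 (3 T)` here, and `9 T² = (3 T)²` in
`sq_scale_le`. -/
lemma l1_scale_le {lam W φ T m B p x : ℝ} {N : ℕ} (hm : 0 < m) (hφ : 0 < φ) (hW : 0 ≤ W)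
    (hup : lam ≤ T * (m⁻¹ * (B * p * √x))) :
    24 * (N : ℝ) * (lam * W / φ ^ 2) ≤ 8 * (3 * T) * N * (W * B * p / (φ ^ 2 * m)) * √x := by
  calc _ ≤ 24 * (N : ℝ) * (T * (m⁻¹ * (B * p * √x)) * W / φ ^ 2) := by gcongr
    _ = _ := by field_simp; ring

lemma sq_scale_le {lam W φ T m B p x : ℝ} {N : ℕ} (hm : 0 < m) (hφ : 0 < φ)
    (hlam : 0 ≤ lam) (hx : 0 ≤ x) (hup : lam ≤ T * (m⁻¹ * (B * p * √x))) :
    9 * (N : ℝ) * (lam ^ 2 * W ^ 2 / φ ^ 2) ≤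
      (3 * T) ^ 2 * N * (W ^ 2 * B ^ 2 * p ^ 2 / (φ ^ 2 * m ^ 2)) * x := by
  calc _ ≤ 9 * (N : ℝ) * ((T * (m⁻¹ * (B * p * √x))) ^ 2 * W ^ 2 / φ ^ 2) := by gcongr
    _ = 9 * (N : ℝ) * (T ^ 2 * (m⁻¹ ^ 2 * (B ^ 2 * p ^ 2 * √x ^ 2)) * W ^ 2 / φ ^ 2) := by ring
    _ = _ := by
      rw [Real.sq_sqrt hx]
      field_simp
      ring

/-- For an empty active set the error bounds are zero, so the estimate must be exact; the penalty
alone forces this, without a restricted eigenvalue. -/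
lemma eq_zero_of_lasso_basic_inequality {m ι : Type*} [Fintype m] [Fintype ι] [DecidableEq ι]
    {A : Matrix m ι ℝ} {u ω : ι → ℝ} {n lam : ℝ} (hn : 0 < n) (hlam : 0 < lam)
    (hω : ∀ j, 0 < ω j)
    (h : 1 / n * l2norm (A.mulVec u) ^ 2 + lam / 2 * ∑ j ∈ (∅ : Finset ι)ᶜ, ω j * |u j| ≤
      3 / 2 * lam * ∑ j ∈ (∅ : Finset ι), ω j * |u j|) : u = 0 := by
  rw [Finset.compl_empty, Finset.sum_empty, mul_zero] at h
  have h1 : 0 ≤ 1 / n * l2norm (A.mulVec u) ^ 2 := by positivity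
  have h2 : ∀ j ∈ Finset.univ, 0 ≤ ω j * |u j| := fun j _ =>
    mul_nonneg (hω j).le (abs_nonneg _)
  have h3 : ∑ j, ω j * |u j| = 0 := by
    refine le_antisymm ?_ (Finset.sum_nonneg h2)
    by_contra hpos
    push Not at hpos
    have : 0 < lam / 2 * ∑ j, ω j * |u j| := by positivity
    linarith
  ext j
  have := (Finset.sum_eq_zero_iff_of_nonneg h2).1 h3 j (Finset.mem_univ j)
  simpa [(hω j).ne'] using this

/-! ### Transfer of the restricted eigenvalue and the bounds on the good event. -/

namespace Setting

variable {Ω : Type*} [MeasurableSpace Ω] {P : Measure Ω} {K : ModelConstants} (S : Setting P K)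

lemma card_rows : (Fintype.card ((k : Fin 2) × Fin (S.n k)) : ℝ) = S.nTot := by
  simp [nTot, Fintype.card_sigma]

lemma nonempty_rows : Nonempty ((k : Fin 2) × Fin (S.n k)) := ⟨⟨0, ⟨0, S.n_pos 0⟩⟩⟩

lemma l2norm_ZHatDrop_sub_col_le {w : Ω} {i : Fin S.p}
    (h : ∀ k j, S.ScoreBound w k j) (c : {j : Fin S.p // j ≠ i} ⊕ {j : Fin S.p // j ≠ i}) :
    l2norm (fun r => (S.ZHatDrop w i - S.XX w * S.PiDrop i) r c) ≤ √(K.calibTot * S.R) := by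
  refine Real.le_sqrt_of_sq_le ?_
  rw [l2norm_sq_sigma, Fin.sum_univ_two, ModelConstants.calibTot, add_mul]
  have hk : ∀ k, l2norm (fun r => (S.ZHatDrop w i - S.XX w * S.PiDrop i) ⟨k, r⟩ c) ^ 2 ≤
      K.calib k * S.R := by
    intro k
    obtain ⟨s, hs, hcol⟩ := exists_reparam_apply_eq c k
    have : (fun r => (S.ZHatDrop w i - S.XX w * S.PiDrop i) ⟨k, r⟩ c) =
        s • (S.X w k).mulVec (S.dev w k (Sum.elim id id c).1) := by
      ext r
      have h1 : (S.XX w * S.PiDrop i) ⟨k, r⟩ c =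
          (S.X w k).mulVec (s • fun l => S.coef k l (Sum.elim id id c).1) r := by
        change (S.XX w).mulVec (fun l => S.PiDrop i l c) ⟨k, r⟩ = _
        rw [XX, blockDiagonal'_mulVec_apply]
        congr 1
        ext l
        rw [PiDrop, hcol]
        rfl
      have h2 : S.ZHatDrop w i ⟨k, r⟩ c =
          (S.X w k).mulVec (s • fun l => S.coefHat w k l (Sum.elim id id c).1) r := by
        rw [ZHatDrop, hcol, Matrix.mulVec_smul]
        rfl
      rw [Matrix.sub_apply, h1, h2, ← Pi.sub_apply, ← Matrix.mulVec_sub, ← smul_sub,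
        Matrix.mulVec_smul]
      rfl
    rw [this, l2norm_smul, hs, one_mul]
    exact S.l2norm_mulVec_dev_sq_le (h k _)
  exact add_le_add (hk 0) (hk 1)

variable {S}

/-- A unit vector at an active index lies in the cone, so `φ₀ √n` is at most the norm of one column
of `X Π_{-i}`, whose two blocks are each at most `c_max √n ‖Π‖₁`. -/
lemma Assumption4.sq_le {i : Fin S.p}
    {ω : Ω → {j : Fin S.p // j ≠ i} ⊕ {j : Fin S.p // j ≠ i} → ℝ} {φ₀ : ℝ}
    (h : S.Assumption4 i ω φ₀) (w : Ω) (hne : (S.active i).Nonempty) :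
    φ₀ ^ 2 ≤ 2 * K.cmax ^ 2 * S.normPi ^ 2 := by
  obtain ⟨j, hj⟩ := hne
  have := S.nonempty_rows
  have hcone : ∑ l ∈ (S.active i)ᶜ, |(Pi.single j 1 : _ → ℝ) l| ≤
      3 * ∑ l ∈ S.active i, |(Pi.single j 1 : _ → ℝ) l| := by
    rw [Finset.sum_eq_zero fun l hl => ?_]
    · exact mul_nonneg (by norm_num) (Finset.sum_nonneg fun _ _ => abs_nonneg _)
    · have : l ≠ j := fun hlj => by simp [hlj, hj] at hl
      simp [this]
  have h1 := mul_l2norm_le_of_le_restrictedEigenvalue (h.restricted_eigenvalue w) hcone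
  have h2 : (fun l : S.active i => (Pi.single j 1 :
      {j : Fin S.p // j ≠ i} ⊕ {j : Fin S.p // j ≠ i} → ℝ) l) = Pi.single ⟨j, hj⟩ 1 := by
    ext l
    simp [Pi.single_apply, Subtype.ext_iff]
  rw [h2, l2norm_single, abs_one, mul_one, card_rows, Matrix.mul_assoc,
    ← Matrix.mulVec_mulVec] at h1
  have h3 := h1.trans (S.l2norm_H_mulVec_le w i _)
  have hn := S.nTot_pos
  have h4 : l2norm ((S.XX w * S.PiDrop i).mulVec (Pi.single j 1)) ^ 2 ≤
      2 * (K.cmax * √S.nTot * S.normPi) ^ 2 := by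
    rw [l2norm_sq_sigma, Fin.sum_univ_two, two_mul]
    have hk : ∀ k, l2norm (fun r => (S.XX w * S.PiDrop i).mulVec (Pi.single j 1) ⟨k, r⟩) ^ 2 ≤
        (K.cmax * √S.nTot * S.normPi) ^ 2 := by
      intro k
      obtain ⟨s, hs, hcol⟩ := exists_reparam_apply_eq j k
      have : (fun r => (S.XX w * S.PiDrop i).mulVec (Pi.single j 1) ⟨k, r⟩) =
          s • (S.X w k).mulVec fun l => S.coef k l (Sum.elim id id j).1 := by
        ext r
        rw [Matrix.mulVec_single_one, ← Matrix.mulVec_smul]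
        change (S.XX w).mulVec (fun l => S.PiDrop i l j) ⟨k, r⟩ = _
        rw [XX, blockDiagonal'_mulVec_apply]
        congr 1
        ext l
        rw [PiDrop, hcol]
        rfl
      rw [this, l2norm_smul, hs, one_mul]
      exact pow_le_pow_left₀ (l2norm_nonneg _) (S.l2norm_X_coef_le w k _) 2
    exact add_le_add (hk 0) (hk 1)
  have h5 := pow_le_pow_left₀ (mul_nonneg h.φ₀_pos.le (Real.sqrt_nonneg _)) h3 2
  have h6 := h5.trans h4
  rw [mul_pow, mul_pow, mul_pow, Real.sq_sqrt hn.le] at h6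
  have h7 : φ₀ ^ 2 * S.nTot ≤ 2 * K.cmax ^ 2 * S.normPi ^ 2 * S.nTot := by linarith
  exact le_of_mul_le_mul_right h7 hn

/-- Upon squaring, `c_max² ‖Π‖₁²` cancels and the nonnegative cross term is dropped. -/
lemma calib_mul_le_of_sample_size {i : Fin S.p} {φ₀ : ℝ} (hne : (S.active i).Nonempty)
    (h : √(S.R / S.nTot) + K.cmax * S.normPi ≤
      √(K.cmax ^ 2 * S.normPi ^ 2 + φ₀ ^ 2 / (64 * K.calibTot * (S.active i).card))) :
    64 * (S.active i).card * (K.calibTot * S.R) ≤ φ₀ ^ 2 * S.nTot := by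
  have hn := S.nTot_pos
  have hR := S.R_nonneg
  have hC := K.calibTot_pos
  have hcm := K.cmax_pos
  have hPi := S.normPi_nonneg
  have hs : (0 : ℝ) < (S.active i).card := Nat.cast_pos.2 hne.card_pos
  have h1 := pow_le_pow_left₀ (by positivity) h 2
  rw [Real.sq_sqrt (by positivity), add_sq, Real.sq_sqrt (by positivity)] at h1
  have h2 : 0 ≤ 2 * √(S.R / S.nTot) * (K.cmax * S.normPi) := by positivity
  have h3 : S.R / S.nTot ≤ φ₀ ^ 2 / (64 * K.calibTot * (S.active i).card) := by nlinarith
  rw [div_le_div_iff₀ hn (by positivity)] at h3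
  linarith

/-- The restricted eigenvalue condition carries over to the calibrated regressors. -/
lemma Assumption4.calibrated {i : Fin S.p}
    {ω : Ω → {j : Fin S.p // j ≠ i} ⊕ {j : Fin S.p // j ≠ i} → ℝ} {φ₀ : ℝ}
    (h : S.Assumption4 i ω φ₀) {w : Ω} (hscore : ∀ k j, S.ScoreBound w k j)
    (hR : 64 * (S.active i).card * (K.calibTot * S.R) ≤ φ₀ ^ 2 * S.nTot)
    {δ : {j : Fin S.p // j ≠ i} ⊕ {j : Fin S.p // j ≠ i} → ℝ}
    (hδ : ∑ j ∈ (S.active i)ᶜ, |δ j| ≤ 3 * ∑ j ∈ S.active i, |δ j|) :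
    φ₀ / 2 * (√S.nTot * l2norm fun j : S.active i => δ j) ≤
      l2norm ((S.H w i * S.ZHatDrop w i).mulVec δ) := by
  have := S.nonempty_rows
  have h1 := mul_l2norm_le_of_le_restrictedEigenvalue (h.restricted_eigenvalue w) hδ
  rw [card_rows] at h1
  set U := l2norm fun j : S.active i => δ j with hU
  have hU0 : 0 ≤ U := l2norm_nonneg _
  have hφ := h.φ₀_pos
  have hdec : (S.H w i * S.XX w * S.PiDrop i).mulVec δ =
      (S.H w i * S.ZHatDrop w i).mulVec δ -
        (S.H w i).mulVec ((S.ZHatDrop w i - S.XX w * S.PiDrop i).mulVec δ) := by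
    rw [Matrix.mulVec_mulVec, ← Matrix.sub_mulVec, Matrix.mul_sub, sub_sub_cancel,
      Matrix.mul_assoc]
  have h2 := (S.l2norm_H_mulVec_le w i _).trans
    (l2norm_mulVec_le_l1norm_mul (S.ZHatDrop w i - S.XX w * S.PiDrop i) δ fun c _ =>
      S.l2norm_ZHatDrop_sub_col_le hscore c)
  have h3 := sum_abs_le_sqrt_card_mul_l2norm (S.active i) δ
  have h4 : l1norm δ ≤ 4 * (√((S.active i).card : ℝ) * U) := by
    rw [l1norm, ← Finset.sum_add_sum_compl (S.active i)]
    linarith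
  -- The constant `64` of the sample size condition is `16 · 4`: the square of the cone factor `4`,
  -- and the square of the `2` in `φ₀ / 2`.
  have h5 : 4 * (√((S.active i).card : ℝ)) * √(K.calibTot * S.R) ≤ φ₀ / 2 * √S.nTot := by
    apply le_of_sq_le_sq _ (by positivity)
    rw [mul_pow, mul_pow, mul_pow, Real.sq_sqrt (Nat.cast_nonneg _),
      Real.sq_sqrt (mul_nonneg K.calibTot_pos.le S.R_nonneg), Real.sq_sqrt S.nTot_pos.le]
    linarith
  rw [hdec] at h1
  have h6 := h1.trans (l2norm_sub_le _ _)
  have h7 : l1norm δ * √(K.calibTot * S.R) ≤ φ₀ / 2 * √S.nTot * U :=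
    calc _ ≤ 4 * (√((S.active i).card : ℝ) * U) * √(K.calibTot * S.R) := by gcongr
      _ = 4 * (√((S.active i).card : ℝ)) * √(K.calibTot * S.R) * U := by ring
      _ ≤ _ := by gcongr
  linarith

/-- The error bounds of the construction stage hold wherever the scores of the calibration stage and
the projected correlations are controlled. -/
theorem adaptiveLasso_error_bounds {i : Fin S.p}
    {ω : Ω → {j : Fin S.p // j ≠ i} ⊕ {j : Fin S.p // j ≠ i} → ℝ} {lam φ₀ T : ℝ} {w : Ω}
    (hp : 2 ≤ S.p) (hd : 0 < S.d) (hrate : 0 < S.rate) (hω : ∀ j, 0 < ω w j)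
    (hA : S.Assumption4 i ω φ₀)
    (hlow : 8 * K.corrConst * ((minAbs (ω w))⁻¹ * S.rate) ≤ lam)
    (hup : lam ≤ T * ((minAbs (ω w))⁻¹ * S.rate))
    (hsize : (S.active i).Nonempty → √(S.R / S.nTot) + K.cmax * S.normPi ≤
      √(K.cmax ^ 2 * S.normPi ^ 2 + φ₀ ^ 2 / (64 * K.calibTot * (S.active i).card)))
    (hscore : ∀ k j, S.ScoreBound w k j)
    (hcorr : ∀ k l, |S.projCorr w k i l| ≤ √(S.n k : ℝ) * S.corrLevel)
    {b : {j : Fin S.p // j ≠ i} ⊕ {j : Fin S.p // j ≠ i} → ℝ}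
    (hb : S.IsAdaptiveLasso w i (ω w) lam b) :
    l1norm (b - S.beta i) ≤ 8 * (3 * T) * (S.active i).card *
        (maxAbsOn (ω w) (S.active i) * S.normB * S.normPi / (φ₀ ^ 2 * minAbs (ω w))) *
        √(S.R * Real.log S.p / S.nMin) ∧
      1 / S.nTot * l2norm ((S.H w i).mulVec ((S.ZHatDrop w i).mulVec (b - S.beta i))) ^ 2 ≤
        (3 * T) ^ 2 * (S.active i).card *
          (maxAbsOn (ω w) (S.active i) ^ 2 * S.normB ^ 2 * S.normPi ^ 2 /
            (φ₀ ^ 2 * minAbs (ω w) ^ 2)) * (S.R * Real.log S.p / S.nMin) := by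
  have hn := S.nTot_pos
  have hφ := hA.φ₀_pos
  have hcc := K.corrConst_pos
  have : Nontrivial (Fin S.p) := Fin.nontrivial_iff_two_le.2 hp
  have : Nonempty {j : Fin S.p // j ≠ i} := nonempty_subtype.2 (exists_ne i)
  have hm : 0 < minAbs (ω w) := minAbs_pos hω
  have hlam : 0 < lam := lt_of_lt_of_le (by positivity) hlow
  -- Combines `64 |S_i| C₂ R ≤ φ₀² n` with `φ₀² ≤ 2 c_max² ‖Π‖₁²`, using `|S_i| ≥ 1`.
  have hact : (S.active i).Nonempty →
      K.calibTot * S.R ≤ S.nTot * K.cmax ^ 2 * S.normPi ^ 2 := by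
    intro hne
    have h1 := calib_mul_le_of_sample_size hne (hsize hne)
    have h2 := mul_le_mul_of_nonneg_right (hA.sq_le w hne) hn.le
    have h3 : (1 : ℝ) ≤ (S.active i).card := by exact_mod_cast hne.card_pos
    have h4 : 0 ≤ K.calibTot * S.R := mul_nonneg K.calibTot_pos.le S.R_nonneg
    have h5 := mul_le_mul_of_nonneg_right h3 h4
    nlinarith
  have hnoise : ∀ c, 4 / S.nTot * |(S.H w i * S.ZHatDrop w i).transpose.mulVec
      ((S.H w i).mulVec (S.Yi w i) - (S.H w i * S.ZHatDrop w i).mulVec (S.beta i)) c| ≤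
      lam * ω w c := by
    intro c
    -- This `b` makes `(4 / n) · 2 b = 8 * corrConst * rate`, which is what the lower bound on `lam`
    -- dominates after multiplication by the smallest weight.
    have h1 := S.abs_transpose_mulVec_residual_le w i c (b := K.corrConst * S.rate * S.nTot)
      fun k j => by
        refine (S.abs_dotProduct_proj_residual_le (hscore k) (hcorr k) j).trans ?_
        have h2 := S.four_div_mul_le_rate hp hd k i hact
        rw [div_mul_eq_mul_div, div_le_iff₀ hn] at h2
        linarith
    have h3 := mul_le_mul_of_nonneg_left h1 (show 0 ≤ 4 / S.nTot by positivity)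
    have h4 : 4 / S.nTot * (2 * (K.corrConst * S.rate * S.nTot)) = 8 * K.corrConst * S.rate := by
      field_simp
      norm_num
    have h5 : 8 * K.corrConst * S.rate ≤ lam * minAbs (ω w) := by
      have := mul_le_mul_of_nonneg_right hlow hm.le
      refine le_trans (le_of_eq ?_) this
      field_simp
    rw [h4] at h3
    exact (h3.trans h5).trans (mul_le_mul_of_nonneg_left (minAbs_le hω c) hlam.le)
  have hmin := hb (Set.mem_univ (S.beta i))
  simp only [Set.mem_ofPred_eq, lassoObjective, Matrix.mulVec_mulVec] at hmin
  have hbasic := lasso_basic_inequality hn (fun j hj => S.beta_eq_zero hj)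
    (fun j => (hω j).le) hlam.le hmin hnoise
  rw [Matrix.mulVec_mulVec]
  set u := b - S.beta i with hu
  by_cases hne : (S.active i).Nonempty
  · have hWj : ∀ j ∈ S.active i, ω w j ≤ maxAbsOn (ω w) (S.active i) := fun j hj =>
      (le_abs_self _).trans (le_ciSup (f := fun j : S.active i => |ω w j|)
        (Set.finite_range _).bddAbove ⟨j, hj⟩)
    have hne' : Nonempty (S.active i) := hne.to_subtype
    have hWl : ∀ l ∉ S.active i, maxAbsOn (ω w) (S.active i) ≤ ω w l := fun l hl =>
      ciSup_le fun j => (hA.weights w j j.2 l hl).trans_eq (abs_of_pos (hω l))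
    obtain ⟨j₀, hj₀⟩ := hne
    have hW : 0 < maxAbsOn (ω w) (S.active i) := (hω j₀).trans_le (hWj j₀ hj₀)
    have hre := fun hcone => hA.calibrated hscore
      (calib_mul_le_of_sample_size ⟨j₀, hj₀⟩ (hsize ⟨j₀, hj₀⟩)) (δ := u) hcone
    obtain ⟨h1, h2⟩ := lasso_error_bounds hn hlam hφ hW hWj hWl hbasic hre
    have hup' : lam ≤ T * ((minAbs (ω w))⁻¹ *
        (S.normB * S.normPi * √(S.R * Real.log S.p / S.nMin))) := hup
    exact ⟨h1.trans (l1_scale_le hm hφ hW.le hup'),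
      h2.trans (sq_scale_le hm hφ hlam.le (div_nonneg (mul_nonneg S.R_nonneg (Real.log_nonneg (by
          exact_mod_cast (by omega : 1 ≤ S.p)))) S.nMin_pos.le) hup')⟩
  · have hS : S.active i = ∅ := Finset.not_nonempty_iff_eq_empty.1 hne
    rw [hS] at hbasic
    have hu0 : u = 0 := eq_zero_of_lasso_basic_inequality hn hlam hω hbasic
    rw [hu0, hS, Matrix.mulVec_zero, l2norm_zero, Finset.card_empty, Nat.cast_zero, mul_zero,
      zero_mul, zero_mul, mul_zero, zero_mul, zero_mul, zero_pow two_ne_zero, mul_zero]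
    exact ⟨(Finset.sum_eq_zero fun j _ => abs_zero).le, le_rfl⟩

end Setting

/-! ### Probability of the exceptional events. -/

namespace Setting

variable {Ω : Type*} [MeasurableSpace Ω] {P : Measure Ω} {K : ModelConstants} (S : Setting P K)

lemma q_pos (hp : 0 < S.p) : 0 < S.q := by
  rcases Nat.eq_zero_or_pos S.q with h | h
  · have h1 := S.p_le
    rw [h, Nat.cast_zero, mul_zero] at h1
    exact absurd (Nat.cast_pos.2 hp) (not_lt.2 h1)
  · exact h

lemma pos_of_h_pos (hp : 1 ≤ S.p) (h : 0 < S.h) : 2 ≤ S.p ∧ 0 < S.d ∧ 0 < S.rate := by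
  have hn := S.nTot_pos
  have hR := S.R_nonneg
  have hB := S.normB_nonneg
  have hPi := S.normPi_nonneg
  have hp2 : 2 ≤ S.p := by
    by_contra hlt
    have : S.p = 1 := by omega
    rw [Setting.h, this] at h
    simp at h
  have hlog : 0 < Real.log S.p := Real.log_pos (by exact_mod_cast hp2)
  have hm1 : 0 ≤ min (S.normB ^ 2) 1 := le_min (sq_nonneg _) zero_le_one
  have hm2 : 0 ≤ min (S.nTot * S.normPi ^ 2 / S.d) S.R := le_min (by positivity) hR
  have h1 : 0 < min (S.normB ^ 2) 1 * min (S.nTot * S.normPi ^ 2 / S.d) S.R :=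
    pos_of_mul_pos_left h hlog.le
  have h2 : 0 < min (S.normB ^ 2) 1 := pos_of_mul_pos_left h1 hm2
  have h3 : 0 < min (S.nTot * S.normPi ^ 2 / S.d) S.R := pos_of_mul_pos_right h1 hm1
  have h4 := (lt_min_iff.1 h3).1
  -- For `d = 0` the quotient by `d` in `h` takes the default value `0`, which would make `h`
  -- nonpositive.
  have hd : 0 < S.d := by
    rcases Nat.eq_zero_or_pos S.d with h0 | h0
    · rw [h0, Nat.cast_zero, div_zero] at h4
      exact absurd h4 (lt_irrefl _)
    · exact h0
  have hB' : 0 < S.normB := hB.lt_of_ne fun h0 => by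
    have := (lt_min_iff.1 h2).1
    rw [← h0] at this
    simp at this
  have hPi' : 0 < S.normPi := hPi.lt_of_ne fun h0 => by
    rw [← h0] at h4
    simp at h4
  have hR' := (lt_min_iff.1 h3).2
  have := S.nMin_pos
  refine ⟨hp2, hd, ?_⟩
  rw [rate]
  positivity

/-- A union bound over `2 q` two-sided tails gives the factor `4 q`; the extra `3 p` is slack. -/
lemma measure_exists_projCorr_ge_le [IsProbabilityMeasure P] (i : Fin S.p) :
    P {w | ∃ k l, √(S.n k : ℝ) * S.corrLevel ≤ |S.projCorr w k i l|} ≤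
      ENNReal.ofReal (3 * Real.exp (-(K.c ^ 2 / (2 * K.σmax ^ 2)) * S.h +
        Real.log (4 * S.p * S.q))) := by
  have hp : 0 < S.p := i.pos
  have hq := S.q_pos hp
  have hlev : 0 ≤ S.corrLevel := mul_nonneg S.normB_nonneg (Real.sqrt_nonneg _)
  set C := K.c ^ 2 / (2 * K.σmax ^ 2) with hC
  have hC0 : 0 ≤ C := by positivity
  have hset : {w | ∃ k l, √(S.n k : ℝ) * S.corrLevel ≤ |S.projCorr w k i l|} =
      ⋃ kl : Fin 2 × Fin S.q,
        {w | √(S.n kl.1 : ℝ) * S.corrLevel ≤ |S.projCorr w kl.1 i kl.2|} := by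
    ext w
    simp
  have hexp : Real.exp (-C * S.corrLevel ^ 2) ≤ Real.exp (-C * S.h) := by
    have := mul_le_mul_of_nonneg_left (S.corrLevel_sq_ge_h hp) hC0
    rw [Real.exp_le_exp]
    linarith
  calc _ ≤ ∑ kl : Fin 2 × Fin S.q,
        P {w | √(S.n kl.1 : ℝ) * S.corrLevel ≤ |S.projCorr w kl.1 i kl.2|} := by
        rw [hset]; exact measure_iUnion_fintype_le _ _
    _ ≤ ∑ _ : Fin 2 × Fin S.q, 2 * ENNReal.ofReal (Real.exp (-C * S.corrLevel ^ 2)) :=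
        Finset.sum_le_sum fun kl _ => S.measure_projCorr_ge_le kl.1 i kl.2 hlev
    _ = ENNReal.ofReal (4 * S.q * Real.exp (-C * S.corrLevel ^ 2)) := by
        rw [Finset.sum_const, Finset.card_univ, Fintype.card_prod, Fintype.card_fin,
          Fintype.card_fin, nsmul_eq_mul, ← mul_assoc, ENNReal.ofReal_mul (by positivity),
          ENNReal.ofReal_mul (by norm_num), ENNReal.ofReal_natCast, ENNReal.ofReal_ofNat]
        push_cast
        ring
    _ ≤ _ := by
        apply ENNReal.ofReal_le_ofReal
        rw [Real.exp_add, Real.exp_log (by positivity)]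
        have h1 : (1 : ℝ) ≤ S.p := by exact_mod_cast hp
        have h2 : (0 : ℝ) ≤ S.q := Nat.cast_nonneg _
        have h3 := Real.exp_pos (-C * S.h)
        calc _ ≤ 4 * S.q * Real.exp (-C * S.h) := by gcongr
          _ = 1 * (4 * S.q * Real.exp (-C * S.h)) := by ring
          _ ≤ (3 * S.p) * (4 * S.q * Real.exp (-C * S.h)) := by gcongr; linarith
          _ = _ := by ring

lemma measure_exists_not_scoreBound_le [IsProbabilityMeasure P] (hp : 0 < S.p) (k : Fin 2) :
    P {w | ∃ j, ¬ S.ScoreBound w k j} ≤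
      ENNReal.ofReal (Real.exp (-S.f k + Real.log S.p)) := by
  have hset : {w | ∃ j, ¬ S.ScoreBound w k j} = ⋃ j, {w | ¬ S.ScoreBound w k j} := by
    ext w
    simp
  rw [hset]
  calc _ ≤ ∑ j, P {w | ¬ S.ScoreBound w k j} := measure_iUnion_fintype_le _ _
    _ ≤ ∑ _ : Fin S.p, ENNReal.ofReal (Real.exp (-S.f k)) :=
        Finset.sum_le_sum fun j _ => S.measure_not_scoreBound_le k j
    _ = _ := by
        rw [Finset.sum_const, Finset.card_univ, Fintype.card_fin, nsmul_eq_mul, Real.exp_add,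
          Real.exp_log (Nat.cast_pos.2 hp), mul_comm (Real.exp _),
          ENNReal.ofReal_mul (Nat.cast_nonneg _), ENNReal.ofReal_natCast]

end Setting

end ReDNet

theorem theorem3 (K : ReDNet.ModelConstants) :
    ∃ C₂ : ℝ, 0 < C₂ ∧
      (∀ (Ω : Type u) [MeasurableSpace Ω] (P : Measure Ω) [IsProbabilityMeasure P]
        (S : ReDNet.Setting P K), S.CalibrationBound C₂) ∧
      ∃ t₀ : ℝ, 0 < t₀ ∧ ∀ T : ℝ, t₀ ≤ T →
        ∃ C₃ C₄ : ℝ, 0 < C₃ ∧ 0 < C₄ ∧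
          ∀ (Ω : Type u) [MeasurableSpace Ω] (P : Measure Ω) [IsProbabilityMeasure P]
            (S : ReDNet.Setting P K) (i : Fin S.p)
            (ω : Ω → {j : Fin S.p // j ≠ i} ⊕ {j : Fin S.p // j ≠ i} → ℝ)
            (lam : Ω → ℝ) (φ₀ : ℝ),
            (∀ w j, 0 < ω w j) →
            S.Assumption4 i ω φ₀ →
            (∀ w, t₀ * ((ReDNet.minAbs (ω w))⁻¹ * S.rate) ≤ lam w ∧
              lam w ≤ T * ((ReDNet.minAbs (ω w))⁻¹ * S.rate)) →
            ((S.active i).Nonempty →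
              √(S.R / S.nTot) + K.cmax * S.normPi ≤
                √(K.cmax ^ 2 * S.normPi ^ 2 + φ₀ ^ 2 / (64 * C₂ * (S.active i).card))) →
            ENNReal.ofReal (1 - 3 * Real.exp (-C₃ * S.h + Real.log (4 * S.p * S.q))
                - Real.exp (-S.f 0 + Real.log S.p) - Real.exp (-S.f 1 + Real.log S.p)) ≤
              P {w | ∀ b, S.IsAdaptiveLasso w i (ω w) (lam w) b →
                ReDNet.l1norm (b - S.beta i) ≤
                    8 * C₄ * (S.active i).card *
                      (ReDNet.maxAbsOn (ω w) (S.active i) * S.normB * S.normPi /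
                        (φ₀ ^ 2 * ReDNet.minAbs (ω w))) *
                      √(S.R * Real.log S.p / S.nMin) ∧
                1 / S.nTot * ReDNet.l2norm ((S.H w i).mulVec
                      ((S.ZHatDrop w i).mulVec (b - S.beta i))) ^ 2 ≤
                    C₄ ^ 2 * (S.active i).card *
                      (ReDNet.maxAbsOn (ω w) (S.active i) ^ 2 * S.normB ^ 2 * S.normPi ^ 2 /
                        (φ₀ ^ 2 * ReDNet.minAbs (ω w) ^ 2)) *
                      (S.R * Real.log S.p / S.nMin)} := by
  have hcc := K.corrConst_pos
  have hc := K.c_pos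
  have hσ := K.σmax_pos
  -- `t₀` is the constant of the noise bound, `C₃` the exponent of the sub-Gaussian tail of a
  -- projected correlation, and `C₄ = 3 T` comes from rescaling the lasso bounds with `lam ≤ T ρ`.
  refine ⟨K.calibTot, K.calibTot_pos, fun Ω _ P _ S => S.calibrationBound,
    8 * K.corrConst, by positivity, fun T hT =>
    ⟨K.c ^ 2 / (2 * K.σmax ^ 2), 3 * T, by positivity, by linarith, ?_⟩⟩
  intro Ω _ P _ S i ω lam φ₀ hω hA hlam hsize
  -- In this case the first exponential is at least `1`, since `4 p q ≥ 1`, and the claimed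
  -- probability is negative. Otherwise `h > 0` provides `p ≥ 2`, `d > 0` and a positive rate, hence
  -- a positive `lam`.
  by_cases hh : S.h ≤ 0
  · have hq := S.q_pos i.pos
    have hp1 : (1 : ℝ) ≤ S.p := by exact_mod_cast i.pos
    have hq1 : (1 : ℝ) ≤ S.q := by exact_mod_cast hq
    have h1 : 1 ≤ Real.exp (-(K.c ^ 2 / (2 * K.σmax ^ 2)) * S.h + Real.log (4 * S.p * S.q)) := by
      apply Real.one_le_exp
      have h2 : 0 ≤ -(K.c ^ 2 / (2 * K.σmax ^ 2)) * S.h :=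
        mul_nonneg_of_nonpos_of_nonpos (neg_nonpos.2 (by positivity)) hh
      have h3 : 0 ≤ Real.log (4 * S.p * S.q) := Real.log_nonneg (by nlinarith)
      linarith
    rw [ENNReal.ofReal_of_nonpos]
    · exact zero_le
    · have := Real.exp_pos (-S.f 0 + Real.log S.p)
      have := Real.exp_pos (-S.f 1 + Real.log S.p)
      linarith
  · obtain ⟨hp, hd, hrate⟩ := S.pos_of_h_pos i.pos (not_le.1 hh)
    refine ReDNet.ofReal_one_sub_le (by positivity) (Real.exp_pos _).le (Real.exp_pos _).le
      (S.measure_exists_projCorr_ge_le i) (S.measure_exists_not_scoreBound_le i.pos 0)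
      (S.measure_exists_not_scoreBound_le i.pos 1) fun w h0 h1 h2 b hb => ?_
    simp only [Set.mem_ofPred_eq, not_exists, not_not, not_le] at h0 h1 h2
    exact ReDNet.Setting.adaptiveLasso_error_bounds hp hd hrate (hω w) hA (hlam w).1 (hlam w).2
      hsize (fun k j => by
        fin_cases k
        · exact h1 j
        · exact h2 j) (fun k l => (h0 k l).le) hb
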